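/- Let $\mathcal N$ be a real nuclear Fréchet space with (strong) dual $\mathcal N'$, whose topology is given by an increasing sequence of Hilbertian norms, and let $\mathcal N_{\mathbb C}$ be its complexification. For a continuous Hilbertian norm $|\cdot|_p$ on $\mathcal N$ let $\mathcal H_p$ be the completion of $(\mathcal N,|\cdot|_p)$; the norms on the complexification $\mathcal H_{p,\mathbb C}$ and on the symmetric Hilbert tensor powers $\mathcal H_{p,\mathbb C}^{\hat\otimes n}$ are again denoted by $|\cdot|_p$, and $\mathcal N_{\mathbb C}^{\hat\otimes n}$ is the projective limit of the spaces $\mathcal H_{p,\mathbb C}^{\hat\otimes n}$. Let $\mu$ be a probability measure on the cylinder $\sigma$-algebra of $\mathcal N'$ whose Laplace transform $l_\mu(\theta)=\int_{\mathcal N'}e^{\langle x,\theta\rangle}\,d\mu(x)$ exists and is holomorphic in a neighbourhood of $0\in\mathcal N_{\mathbb C}$. For $x\in\mathcal N'$ let $P_n^\mu(x)$ be the continuous linear functional on $\mathcal N_{\mathbb C}^{\hat\otimes n}$ determined by $$\frac{e^{\langle x,\theta\rangle}}{l_\mu(\theta)}=\sum_{n=0}^\infty\frac1{n!}\langle P_n^\mu(x),\theta^{\otimes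 n}\rangle\qquad(\theta\in\mathcal N_{\mathbb C}\text{ near }0).$$ Let $\mathcal P(\mathcal N')$ be the space of smooth polynomials on $\mathcal N'$, i.e. of the functions $\varphi=\sum_{n=0}^{m}\langle P_n^\mu(\cdot),\varphi^{(n)}\rangle$ with $m\in\mathbb N$ and $\varphi^{(n)}\in\mathcal N_{\mathbb C}^{\hat\otimes n}$ (the kernels $\varphi^{(n)}$ are unique). Let $(|\cdot|_p)_{p\in\mathbb N}$ be any system of Hilbertian norms on $\mathcal N$ that is increasing in $p$ and defines the topology of $\mathcal N$. For $p,q\in\mathbb N$ let $(\mathcal H_p)^1_{q,\mu}$ be the completion of $\mathcal P(\mathcal N')$ with respect to the norm $$\|\varphi\|_{p,q,\mu}^2=\sum_{n}(n!)^2\,2^{nq}\,|\varphi^{(n)}|_p^2 ,$$ and let $(\mathcal N)^1_\mu=\operatorname{pr\,lim}_{p,q\in\mathbb N}(\mathcal H_p)^1_{q,\mu}$ be the projective limit with respect to the canonical maps. **Theorem.** (i) $(\mathcal N)^1_\mu$ is a nuclear space. (ii) $(\mathcal N)^1_\mu$ with its topology is uniquely determined by the topology of $\mathcal N$ and does not depend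 on the choice of the system of norms: if $(|\cdot|_p)$ and $(|\cdot|'_k)$ are two such systems, then there is a unique isomorphism of topological vector spaces between the two resulting spaces $(\mathcal N)^1_\mu$ which restricts to the identity on $\mathcal P(\mathcal N')$. -/

import Mathlib

open MeasureTheory Filter Topology UniformSpace

noncomputable section

/-! ### Local Banach spaces of seminorms, nuclear maps and nuclear spaces -/

section Nuclear

/-- The vector space `V`, regarded as a seminormed space by means of the seminorm `p`. -/
def SeminormedCopy {𝕜 V : Type*} [RCLike 𝕜] [AddCommGroup V] [Module 𝕜 V]
    (_p : Seminorm 𝕜 V) : Type _ := V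

instance {𝕜 V : Type*} [RCLike 𝕜] [AddCommGroup V] [Module 𝕜 V] (p : Seminorm 𝕜 V) :
    SeminormedAddCommGroup (SeminormedCopy p) :=
  p.toAddGroupSeminorm.toSeminormedAddCommGroup

instance {𝕜 V : Type*} [RCLike 𝕜] [AddCommGroup V] [Module 𝕜 V] (p : Seminorm 𝕜 V) :
    Module 𝕜 (SeminormedCopy p) := inferInstanceAs (Module 𝕜 V)

instance {𝕜 V : Type*} [RCLike 𝕜] [AddCommGroup V] [Module 𝕜 V] (p : Seminorm 𝕜 V) :
    NormedSpace 𝕜 (SeminormedCopy p) where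
  norm_smul_le a x := (map_smul_eq_mul p a x).le

/-- The Banach space attached to a seminorm `p` on `V`: the Hausdorff completion of `(V, p)`. -/
abbrev LocalBanach {𝕜 V : Type*} [RCLike 𝕜] [AddCommGroup V] [Module 𝕜 V]
    (p : Seminorm 𝕜 V) : Type _ := Completion (SeminormedCopy p)

/-- The canonical image of a vector of `V` in the completion of `(V, p)`. -/
def toLocalBanach {𝕜 V : Type*} [RCLike 𝕜] [AddCommGroup V] [Module 𝕜 V]
    (p : Seminorm 𝕜 V) (v : V) : LocalBanach p :=
  ((show SeminormedCopy p from v : SeminormedCopy p) : Completion (SeminormedCopy p))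

/-- For `p ≤ q`, the canonical map from the completion of `(V, q)` to the completion of `(V, p)`:
the continuous extension of the identity of `V`. -/
def canonicalMap {𝕜 V : Type*} [RCLike 𝕜] [AddCommGroup V] [Module 𝕜 V]
    {p q : Seminorm 𝕜 V} (hpq : p ≤ q) : LocalBanach q →L[𝕜] LocalBanach p :=
  ContinuousLinearMap.completion
    (LinearMap.mkContinuous
      ({ toFun := fun v => v, map_add' := fun _ _ => rfl, map_smul' := fun _ _ => rfl } :
        SeminormedCopy q →ₗ[𝕜] SeminormedCopy p) 1
      (fun v => (hpq v).trans (one_mul (q v)).ge))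

theorem canonicalMap_toLocalBanach {𝕜 V : Type*} [RCLike 𝕜] [AddCommGroup V] [Module 𝕜 V]
    {p q : Seminorm 𝕜 V} (hpq : p ≤ q) (v : V) :
    canonicalMap hpq (toLocalBanach q v) = toLocalBanach p v :=
  ContinuousLinearMap.completion_apply_coe _ _

/-- A nuclear map between Banach spaces: `T x = ∑ₙ fₙ(x) yₙ` with `∑ₙ ‖fₙ‖ ‖yₙ‖ < ∞`. -/
def IsNuclearMap {𝕜 X Y : Type*} [RCLike 𝕜] [NormedAddCommGroup X] [NormedSpace 𝕜 X]
    [NormedAddCommGroup Y] [NormedSpace 𝕜 Y] (T : X →L[𝕜] Y) : Prop :=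
  ∃ (f : ℕ → StrongDual 𝕜 X) (y : ℕ → Y),
    Summable (fun n => ‖f n‖ * ‖y n‖) ∧ ∀ x, HasSum (fun n => f n x • y n) (T x)

/-- A nuclear space in the sense of Grothendieck: a Hausdorff locally convex space such that every
continuous seminorm `p` is dominated by a continuous seminorm `q` for which the canonical map
between the completions of `(E, q)` and `(E, p)` is nuclear. (Local convexity is the requirement
that the continuous seminorms define the topology.) -/
structure IsNuclearSpace (𝕜 E : Type*) [RCLike 𝕜] [AddCommGroup E] [Module 𝕜 E]
    [TopologicalSpace E] : Prop where
  isTopologicalAddGroup : IsTopologicalAddGroup E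
  continuousSMul : ContinuousSMul 𝕜 E
  t2 : T2Space E
  locallyConvex : ∀ U ∈ 𝓝 (0 : E), ∃ p : Seminorm 𝕜 E, Continuous p ∧ {x | p x < 1} ⊆ U
  nuclear : ∀ p : Seminorm 𝕜 E, Continuous p →
    ∃ (q : Seminorm 𝕜 E) (hpq : p ≤ q), Continuous q ∧ IsNuclearMap (canonicalMap hpq)

end Nuclear

/-! ### Hilbertian norms -/

section Hilbertian

/-- A continuous Hilbertian norm on `N`, given by its inner product. -/
structure HilbertianNorm (N : Type*) [AddCommGroup N] [Module ℝ N] [TopologicalSpace N] where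
  core : InnerProductSpace.Core ℝ N
  continuous_inner_self : Continuous fun ξ : N => core.inner ξ ξ

namespace HilbertianNorm

variable {N : Type*} [AddCommGroup N] [Module ℝ N] [TopologicalSpace N]

/-- `N` as a pre-Hilbert space with the Hilbertian norm `h`. -/
def Copy (_h : HilbertianNorm N) : Type _ := N

instance (h : HilbertianNorm N) : NormedAddCommGroup h.Copy :=
  @InnerProductSpace.Core.toNormedAddCommGroup ℝ N _ _ _ h.core

instance (h : HilbertianNorm N) : InnerProductSpace ℝ h.Copy :=
  @InnerProductSpace.ofCore ℝ N _ _ _ h.core.toCore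

/-- The Hilbert space `H_h`, the completion of `N` with respect to `h`. -/
abbrev Space (h : HilbertianNorm N) : Type _ := Completion h.Copy

/-- The identity of `N`, as a map onto the pre-Hilbert space `(N, h)`. -/
def toCopy (h : HilbertianNorm N) : N →ₗ[ℝ] h.Copy where
  toFun ξ := ξ
  map_add' _ _ := rfl
  map_smul' _ _ := rfl

/-- The norm `|ξ|_h` as a seminorm on `N`. -/
def seminorm (h : HilbertianNorm N) : Seminorm ℝ N := (normSeminorm ℝ h.Copy).comp h.toCopy

theorem seminorm_apply (h : HilbertianNorm N) (ξ : N) : h.seminorm ξ = ‖h.toCopy ξ‖ := rfl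

theorem seminorm_eq_sqrt (h : HilbertianNorm N) (ξ : N) :
    h.seminorm ξ = √(h.core.inner ξ ξ) := rfl

theorem continuous_seminorm (h : HilbertianNorm N) : Continuous h.seminorm :=
  Real.continuous_sqrt.comp h.continuous_inner_self

variable [IsTopologicalAddGroup N]

theorem continuous_toCopy (h : HilbertianNorm N) : Continuous h.toCopy := by
  refine continuous_of_continuousAt_zero h.toCopy ?_
  rw [ContinuousAt, map_zero, tendsto_zero_iff_norm_tendsto_zero]
  have := h.continuous_seminorm.tendsto 0
  rwa [map_zero] at this

/-- The element `ξ ↦ (e, ξ)_h` of the dual of `N` that is given by `e ∈ H_h`. By the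
Riesz theorem, this is an isometric identification of `H_h` with the dual Hilbert space `H_{-h}`,
a linear subspace of the dual of `N`. -/
def riesz (h : HilbertianNorm N) (e : h.Space) : StrongDual ℝ N where
  toFun ξ := inner ℝ e (h.toCopy ξ : h.Space)
  map_add' ξ η := by rw [map_add, Completion.coe_add, inner_add_right]
  map_smul' a ξ := by
    rw [map_smul, Completion.coe_smul, inner_smul_right]; rfl
  cont := continuous_const.inner ((Completion.continuous_coe _).comp h.continuous_toCopy)

/-- A finite orthonormal family in `H_h` (equivalently, in its dual `H_{-h}`). -/
structure Frame (h : HilbertianNorm N) where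
  size : ℕ
  vec : Fin size → h.Space
  orthonormal : Orthonormal ℝ vec

instance (h : HilbertianNorm N) : Nonempty h.Frame :=
  ⟨⟨0, Fin.elim0, ⟨fun i => i.elim0, fun i => i.elim0⟩⟩⟩

end HilbertianNorm

/-- A system of Hilbertian norms `(|·|_p)_{p ∈ ℕ}` on `N` that is increasing in `p` and that
defines the topology of `N`. -/
structure HilbertianSystem (N : Type*) [AddCommGroup N] [Module ℝ N] [TopologicalSpace N] where
  norm : ℕ → HilbertianNorm N
  mono : ∀ p p' : ℕ, p ≤ p' → (norm p).seminorm ≤ (norm p').seminorm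
  withSeminorms : WithSeminorms fun p => (norm p).seminorm

end Hilbertian

/-! ### Symmetric tensor powers -/

section Kernels

variable {N : Type*} [AddCommGroup N] [Module ℝ N] [TopologicalSpace N] [IsTopologicalAddGroup N]

/-- The `ℓ²` norm `(∑_J |A(e_{J 1}, …, e_{J n})|²)^{1/2}` of the coefficients of a complex-valued
`n`-linear form `A` on the dual of `N`, for a finite orthonormal family `e` in the Hilbert
space `H_{-h}`. -/
def frameNorm {n : ℕ} (h : HilbertianNorm N)
    (A : MultilinearMap ℝ (fun _ : Fin n => StrongDual ℝ N) ℂ) (F : h.Frame) : ℝ :=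
  ‖(WithLp.toLp 2 fun J : Fin n → Fin F.size => A fun i => h.riesz (F.vec (J i)) :
    EuclideanSpace ℂ (Fin n → Fin F.size))‖

theorem frameNorm_nonneg {n : ℕ} (h : HilbertianNorm N)
    (A : MultilinearMap ℝ (fun _ : Fin n => StrongDual ℝ N) ℂ) (F : h.Frame) :
    0 ≤ frameNorm h A F := norm_nonneg _

theorem frameNorm_zero {n : ℕ} (h : HilbertianNorm N) (F : h.Frame) :
    frameNorm h (0 : MultilinearMap ℝ (fun _ : Fin n => StrongDual ℝ N) ℂ) F = 0 :=
  norm_zero (E := EuclideanSpace ℂ (Fin n → Fin F.size))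

theorem frameNorm_add_le {n : ℕ} (h : HilbertianNorm N)
    (A B : MultilinearMap ℝ (fun _ : Fin n => StrongDual ℝ N) ℂ) (F : h.Frame) :
    frameNorm h (A + B) F ≤ frameNorm h A F + frameNorm h B F := by
  unfold frameNorm
  rw [show (WithLp.toLp 2 fun J : Fin n → Fin F.size => (A + B) fun i => h.riesz (F.vec (J i)) :
      EuclideanSpace ℂ (Fin n → Fin F.size)) =
    (WithLp.toLp 2 fun J : Fin n → Fin F.size => A fun i => h.riesz (F.vec (J i))) +
    (WithLp.toLp 2 fun J : Fin n → Fin F.size => B fun i => h.riesz (F.vec (J i))) from rfl]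
  exact norm_add_le _ _

theorem frameNorm_smul {n : ℕ} (h : HilbertianNorm N) (a : ℂ)
    (A : MultilinearMap ℝ (fun _ : Fin n => StrongDual ℝ N) ℂ) (F : h.Frame) :
    frameNorm h (a • A) F = ‖a‖ * frameNorm h A F :=
  norm_smul a (WithLp.toLp 2 fun J : Fin n → Fin F.size => A fun i => h.riesz (F.vec (J i)) :
    EuclideanSpace ℂ (Fin n → Fin F.size))

theorem frameNorm_sq {n : ℕ} (h : HilbertianNorm N)
    (A : MultilinearMap ℝ (fun _ : Fin n => StrongDual ℝ N) ℂ) (F : h.Frame) :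
    frameNorm h A F ^ 2 =
      ∑ J : Fin n → Fin F.size, ‖A fun i => h.riesz (F.vec (J i))‖ ^ 2 :=
  EuclideanSpace.norm_sq_eq _

variable (N) in
/-- The `n`-th completed symmetric tensor power of the complexification of `N`, the projective limit
of the symmetric Hilbert tensor powers of the complexified Hilbert spaces `H_h`.

The Hilbert tensor power `H_h ⊗ ⋯ ⊗ H_h` is taken as the space of Hilbert-Schmidt `n`-linear forms
on the dual Hilbert space `H_{-h}`, with the Hilbert-Schmidt norm (`ξ₁ ⊗ ⋯ ⊗ ξₙ` being the form
`(x₁, …, xₙ) ↦ ∏ ⟨xᵢ, ξᵢ⟩`); a consistent family of such forms is a form on the union of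
the spaces `H_{-h}`, the dual of `N`. All continuous Hilbertian norms `h` are used here, so that
the space does not refer to a system of norms; a system of Hilbertian norms which defines
the topology of `N` gives the same space. -/
def Kernel (n : ℕ) : Submodule ℂ (MultilinearMap ℝ (fun _ : Fin n => StrongDual ℝ N) ℂ) where
  carrier := {A | (∀ (σ : Equiv.Perm (Fin n)) (x : Fin n → StrongDual ℝ N),
      A (fun i => x (σ i)) = A x) ∧
    ∀ h : HilbertianNorm N, BddAbove (Set.range (frameNorm h A))}
  zero_mem' := by
    refine ⟨fun σ x => rfl, fun h => ⟨0, ?_⟩⟩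
    rintro _ ⟨F, rfl⟩
    exact (frameNorm_zero h F).le
  add_mem' := by
    rintro A B ⟨hA, hA'⟩ ⟨hB, hB'⟩
    refine ⟨fun σ x => by simp [hA σ x, hB σ x], fun h => ?_⟩
    obtain ⟨a, ha⟩ := hA' h
    obtain ⟨b, hb⟩ := hB' h
    refine ⟨a + b, ?_⟩
    rintro _ ⟨F, rfl⟩
    exact (frameNorm_add_le h A B F).trans (add_le_add (ha ⟨F, rfl⟩) (hb ⟨F, rfl⟩))
  smul_mem' := by
    rintro c A ⟨hA, hA'⟩
    refine ⟨fun σ x => by simp [hA σ x], fun h => ?_⟩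
    obtain ⟨a, ha⟩ := hA' h
    refine ⟨‖c‖ * a, ?_⟩
    rintro _ ⟨F, rfl⟩
    rw [frameNorm_smul]
    exact mul_le_mul_of_nonneg_left (ha ⟨F, rfl⟩) (norm_nonneg c)

/-- The norm `|φ⁽ⁿ⁾|_h` of the Hilbert tensor power, i.e. the Hilbert-Schmidt norm on `H_{-h}`:
the supremum over all finite orthonormal families of the `ℓ²` norms of the coefficients. -/
def kernelNorm {n : ℕ} (h : HilbertianNorm N) : Seminorm ℂ (Kernel N n) :=
  Seminorm.ofSMulLE (fun A => ⨆ F : h.Frame, frameNorm h A.1 F)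
    (by simp [frameNorm_zero])
    (fun A B => ciSup_le fun F => (frameNorm_add_le h A.1 B.1 F).trans
      (add_le_add (le_ciSup (A.2.2 h) F) (le_ciSup (B.2.2 h) F)))
    (fun c A => ciSup_le fun F => by
      have : frameNorm h (c • A).1 F = ‖c‖ * frameNorm h A.1 F := frameNorm_smul h c A.1 F
      rw [this]
      exact mul_le_mul_of_nonneg_left (le_ciSup (A.2.2 h) F) (norm_nonneg c))

theorem kernelNorm_apply {n : ℕ} (h : HilbertianNorm N) (A : Kernel N n) :
    kernelNorm h A = ⨆ F : h.Frame, frameNorm h A.1 F := rfl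

/-- Applying a matrix of norm at most `C` to the arguments of an `n`-linear form multiplies the sum
of the squares of its coefficients by at most `C ^ (2 * n)`. -/
theorem sum_sq_multilinear_le {W : Type*} [AddCommGroup W] [Module ℝ W] {k m : ℕ} (u : Fin k → W)
    (T : Fin m → Fin k → ℝ) (C : ℝ)
    (hT : ∀ a : Fin k → ℝ, ∑ j, (∑ i, T j i * a i) ^ 2 ≤ C ^ 2 * ∑ i, a i ^ 2) :
    ∀ (n : ℕ) (A : MultilinearMap ℝ (fun _ : Fin n => W) ℂ),
      ∑ J : Fin n → Fin m, ‖A fun l => ∑ i, T (J l) i • u i‖ ^ 2 ≤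
        (C ^ 2) ^ n * ∑ I : Fin n → Fin k, ‖A fun l => u (I l)‖ ^ 2 := by
  have hTc : ∀ a : Fin k → ℂ, ∑ j, ‖∑ i, T j i • a i‖ ^ 2 ≤ C ^ 2 * ∑ i, ‖a i‖ ^ 2 := by
    intro a
    have h1 := hT fun i => (a i).re
    have h2 := hT fun i => (a i).im
    have h3 : ∀ z : ℂ, ‖z‖ ^ 2 = z.re ^ 2 + z.im ^ 2 := fun z => by
      rw [Complex.sq_norm, Complex.normSq_apply]; ring
    simp only [h3, Complex.re_sum, Complex.im_sum, Complex.real_smul, Complex.re_ofReal_mul,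
      Complex.im_ofReal_mul, Finset.sum_add_distrib, mul_add]
    exact add_le_add h1 h2
  intro n
  induction n with
  | zero =>
    intro A
    have h0 : ∀ v : Fin 0 → W, A v = A Fin.elim0 := fun v => congrArg A (Subsingleton.elim _ _)
    simp [h0]
  | succ n ih =>
    intro A
    have e1 : ∀ f : (Fin (n + 1) → Fin m) → ℝ, ∑ J, f J = ∑ j, ∑ J', f (Fin.cons j J') := fun f => by
      rw [← (Fin.consEquiv fun _ : Fin (n + 1) => Fin m).sum_comp, Fintype.sum_prod_type]; rfl
    have e2 : ∀ f : (Fin (n + 1) → Fin k) → ℝ, ∑ J, f J = ∑ j, ∑ J', f (Fin.cons j J') := fun f => by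
      rw [← (Fin.consEquiv fun _ : Fin (n + 1) => Fin k).sum_comp, Fintype.sum_prod_type]; rfl
    have c1 : ∀ (j : Fin m) (J' : Fin n → Fin m),
        (fun l => ∑ i, T ((Fin.cons j J' : Fin (n + 1) → Fin m) l) i • u i) =
          Fin.cons (∑ i, T j i • u i) (fun l => ∑ i, T (J' l) i • u i) := by
      intro j J'
      funext l
      refine Fin.cases ?_ (fun l => ?_) l <;> simp
    have c2 : ∀ (j : Fin k) (J' : Fin n → Fin k),
        (fun l => u ((Fin.cons j J' : Fin (n + 1) → Fin k) l)) =
          Fin.cons (u j) (fun l => u (J' l)) := by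
      intro j J'
      funext l
      refine Fin.cases ?_ (fun l => ?_) l <;> simp
    rw [e1, e2]
    simp only [c1, c2, ← MultilinearMap.curryLeft_apply]
    calc _ ≤ ∑ j, (C ^ 2) ^ n * ∑ I : Fin n → Fin k,
          ‖A.curryLeft (∑ i, T j i • u i) fun l => u (I l)‖ ^ 2 :=
          Finset.sum_le_sum fun j _ => ih _
      _ = (C ^ 2) ^ n * ∑ I : Fin n → Fin k, ∑ j,
          ‖∑ i, T j i • A.curryLeft (u i) (fun l => u (I l))‖ ^ 2 := by
          rw [← Finset.mul_sum, Finset.sum_comm]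
          simp only [map_sum, map_smul, sum_apply, smul_apply]
      _ ≤ (C ^ 2) ^ n * ∑ I : Fin n → Fin k, (C ^ 2 * ∑ i,
          ‖A.curryLeft (u i) (fun l => u (I l))‖ ^ 2) := by
          gcongr with I _
          exact hTc _
      _ = _ := by
          rw [← Finset.mul_sum, Finset.sum_comm, ← mul_assoc, ← pow_succ]

/-- The Hilbert-Schmidt norm is monotone in the Hilbertian norm. -/
theorem frameNorm_le_of_le {n : ℕ} {h h' : HilbertianNorm N} {C : ℝ} (hC : 0 ≤ C)
    (hle : ∀ ξ, h.seminorm ξ ≤ C * h'.seminorm ξ)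
    (A : MultilinearMap ℝ (fun _ : Fin n => StrongDual ℝ N) ℂ) (F : h.Frame) :
    ∃ F' : h'.Frame, frameNorm h A F ≤ C ^ n * frameNorm h' A F' := by
  let i₀ : h'.Copy →L[ℝ] h.Copy := LinearMap.mkContinuous
    ({ toFun := fun v => v, map_add' := fun _ _ => rfl, map_smul' := fun _ _ => rfl } :
        h'.Copy →ₗ[ℝ] h.Copy) C hle
  let i : h'.Space →L[ℝ] h.Space := i₀.completion
  have hi : ∀ ξ : N, i (h'.toCopy ξ : h'.Space) = (h.toCopy ξ : h.Space) := fun ξ =>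
    ContinuousLinearMap.completion_apply_coe _ _
  have hin : ∀ v : h'.Space, ‖i v‖ ≤ C * ‖v‖ := by
    intro v
    induction v using Completion.induction_on with
    | hp => exact isClosed_le (i.continuous.norm) (continuous_const.mul continuous_norm)
    | ih v =>
      have := hle v
      have e : i (v : h'.Space) = ((i₀ v : h.Copy) : h.Space) :=
        ContinuousLinearMap.completion_apply_coe _ _
      rw [e, Completion.norm_coe, Completion.norm_coe]
      exact this
  let g : Fin F.size → h'.Space := fun j => ContinuousLinearMap.adjoint i (F.vec j)
  have hg : ∀ j, h'.riesz (g j) = h.riesz (F.vec j) := by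
    intro j
    ext ξ
    change inner ℝ (ContinuousLinearMap.adjoint i (F.vec j)) (h'.toCopy ξ : h'.Space) =
      inner ℝ (F.vec j) (h.toCopy ξ : h.Space)
    rw [ContinuousLinearMap.adjoint_inner_left, hi]
  let S : Submodule ℝ h'.Space := Submodule.span ℝ (Set.range g)
  have : FiniteDimensional ℝ S := FiniteDimensional.span_of_finite ℝ (Set.finite_range g)
  let b := stdOrthonormalBasis ℝ S
  let u : Fin (Module.finrank ℝ S) → h'.Space := fun l => (b l : h'.Space)
  have hu : Orthonormal ℝ u := b.orthonormal.comp_linearIsometry S.subtypeₗᵢ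
  let T : Fin F.size → Fin (Module.finrank ℝ S) → ℝ := fun j l => inner ℝ (u l) (g j)
  have hgu : ∀ j, g j = ∑ l, T j l • u l := by
    intro j
    have hgS : g j ∈ S := Submodule.subset_span ⟨j, rfl⟩
    have := congrArg (Subtype.val) (b.sum_repr' ⟨g j, hgS⟩)
    simp only [Submodule.coe_sum, Submodule.coe_smul, Submodule.coe_inner] at this
    exact this.symm
  have hadd : ∀ x y : h'.Space, h'.riesz (x + y) = h'.riesz x + h'.riesz y := fun x y => by
    ext ξ; exact inner_add_left x y (h'.toCopy ξ : h'.Space)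
  have hsm : ∀ (a : ℝ) (x : h'.Space), h'.riesz (a • x) = a • h'.riesz x := fun a x => by
    ext ξ; exact real_inner_smul_left x (h'.toCopy ξ : h'.Space) a
  let R : h'.Space →ₗ[ℝ] StrongDual ℝ N := ⟨⟨h'.riesz, hadd⟩, hsm⟩
  have hR : ∀ j, h.riesz (F.vec j) = ∑ l, T j l • h'.riesz (u l) := by
    intro j
    rw [← hg j]
    change R (g j) = ∑ l, T j l • R (u l)
    rw [hgu j, map_sum]
    simp only [map_smul]
  have hT : ∀ a : Fin (Module.finrank ℝ S) → ℝ,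
      ∑ j, (∑ l, T j l * a l) ^ 2 ≤ C ^ 2 * ∑ l, a l ^ 2 := by
    intro a
    let v : h'.Space := ∑ l, a l • u l
    have hv : ‖v‖ ^ 2 = ∑ l, a l ^ 2 := by
      have := hu.inner_sum a a Finset.univ
      rw [← real_inner_self_eq_norm_sq]
      change inner ℝ (∑ l, a l • u l) (∑ l, a l • u l) = _
      rw [this]
      exact Finset.sum_congr rfl fun l _ => by simp [sq]
    have h1 : ∀ j, ∑ l, T j l * a l = inner ℝ (F.vec j) (i v) := by
      intro j
      rw [← ContinuousLinearMap.adjoint_inner_left]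
      change _ = inner ℝ (g j) (∑ l, a l • u l)
      rw [inner_sum]
      refine Finset.sum_congr rfl fun l _ => ?_
      rw [real_inner_smul_right, real_inner_comm, mul_comm]
    have h2 := F.orthonormal.sum_inner_products_le (i v) (s := Finset.univ)
    simp only [h1]
    calc ∑ j, (inner ℝ (F.vec j) (i v)) ^ 2 = ∑ j, ‖inner ℝ (F.vec j) (i v)‖ ^ 2 := by
          simp
      _ ≤ ‖i v‖ ^ 2 := h2
      _ ≤ (C * ‖v‖) ^ 2 := by gcongr; exact hin v
      _ = C ^ 2 * ∑ l, a l ^ 2 := by rw [mul_pow, hv]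
  refine ⟨⟨_, u, hu⟩, ?_⟩
  have key := sum_sq_multilinear_le (fun l => h'.riesz (u l)) T C hT n A
  simp only [← hR] at key
  refine (sq_le_sq₀ (frameNorm_nonneg _ _ _) ?_).1 ?_
  · exact mul_nonneg (pow_nonneg hC n) (frameNorm_nonneg _ _ _)
  rw [mul_pow, frameNorm_sq, frameNorm_sq, ← pow_mul, mul_comm n 2, pow_mul]
  exact key

theorem kernelNorm_mono {n : ℕ} {h h' : HilbertianNorm N} (hle : h.seminorm ≤ h'.seminorm)
    (A : Kernel N n) : kernelNorm h A ≤ kernelNorm h' A := by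
  rw [kernelNorm_apply, kernelNorm_apply]
  refine ciSup_le fun F => ?_
  obtain ⟨F', hF'⟩ := frameNorm_le_of_le (h := h) (h' := h') (C := 1) zero_le_one
    (fun ξ => by rw [one_mul]; exact hle ξ) A.1 F
  rw [one_pow, one_mul] at hF'
  exact hF'.trans (le_ciSup (A.2.2 h') F')

end Kernels

/-! ### Complexification, analytic measures and the generalized Appell polynomials -/

section Complexification

/-- The complexification of `N`: the pairs `(ξ, η)`, standing for `ξ + i η`. -/
def Complexification (N : Type*) : Type _ := N × N

variable {N : Type*} [AddCommGroup N] [Module ℝ N] [TopologicalSpace N]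

instance : AddCommGroup (Complexification N) := inferInstanceAs (AddCommGroup (N × N))

instance : TopologicalSpace (Complexification N) := inferInstanceAs (TopologicalSpace (N × N))

instance : Module ℂ (Complexification N) where
  smul z θ := (z.re • θ.1 - z.im • θ.2, z.im • θ.1 + z.re • θ.2)
  one_smul θ := Prod.ext
    (show (1 : ℂ).re • θ.1 - (1 : ℂ).im • θ.2 = θ.1 by simp)
    (show (1 : ℂ).im • θ.1 + (1 : ℂ).re • θ.2 = θ.2 by simp)
  mul_smul z w θ := Prod.ext
    (show (z * w).re • θ.1 - (z * w).im • θ.2 = z.re • (w.re • θ.1 - w.im • θ.2) -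
      z.im • (w.im • θ.1 + w.re • θ.2) by simp only [Complex.mul_re, Complex.mul_im]; module)
    (show (z * w).im • θ.1 + (z * w).re • θ.2 = z.im • (w.re • θ.1 - w.im • θ.2) +
      z.re • (w.im • θ.1 + w.re • θ.2) by simp only [Complex.mul_re, Complex.mul_im]; module)
  smul_zero z := Prod.ext
    (show z.re • (0 : N) - z.im • (0 : N) = 0 by simp)
    (show z.im • (0 : N) + z.re • (0 : N) = 0 by simp)
  smul_add z θ θ' := Prod.ext
    (show z.re • (θ.1 + θ'.1) - z.im • (θ.2 + θ'.2) =
      (z.re • θ.1 - z.im • θ.2) + (z.re • θ'.1 - z.im • θ'.2) by module)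
    (show z.im • (θ.1 + θ'.1) + z.re • (θ.2 + θ'.2) =
      (z.im • θ.1 + z.re • θ.2) + (z.im • θ'.1 + z.re • θ'.2) by module)
  add_smul z w θ := Prod.ext
    (show (z + w).re • θ.1 - (z + w).im • θ.2 =
      (z.re • θ.1 - z.im • θ.2) + (w.re • θ.1 - w.im • θ.2) by
        simp only [Complex.add_re, Complex.add_im]; module)
    (show (z + w).im • θ.1 + (z + w).re • θ.2 =
      (z.im • θ.1 + z.re • θ.2) + (w.im • θ.1 + w.re • θ.2) by
        simp only [Complex.add_re, Complex.add_im]; module)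
  zero_smul θ := Prod.ext
    (show (0 : ℂ).re • θ.1 - (0 : ℂ).im • θ.2 = 0 by simp)
    (show (0 : ℂ).im • θ.1 + (0 : ℂ).re • θ.2 = 0 by simp)

/-- The dual pairing `⟨x, ξ + i η⟩ = ⟨x, ξ⟩ + i ⟨x, η⟩`, for `x` in the dual of `N`. -/
def complexPairing (x : StrongDual ℝ N) (θ : Complexification N) : ℂ :=
  (x θ.1 : ℂ) + Complex.I * (x θ.2 : ℂ)

variable (N) in
/-- The σ-algebra on the dual of `N` that is generated by the cylinder sets. -/
@[reducible]
def cylinderSigma : MeasurableSpace (StrongDual ℝ N) :=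
  ⨆ ξ : N, MeasurableSpace.comap (fun x : StrongDual ℝ N => x ξ) (borel ℝ)

/-- The Laplace transform `l_μ(θ) = ∫ exp ⟨x, θ⟩ dμ(x)`. -/
def laplaceTransform (μ : @Measure (StrongDual ℝ N) (cylinderSigma N))
    (θ : Complexification N) : ℂ :=
  ∫ x, Complex.exp (complexPairing x θ) ∂μ

/-- Holomorphy on a set `U` of the complexification of `N`: the function is Gâteaux holomorphic
(holomorphic along complex lines) and locally bounded. -/
def IsHolomorphicOn (F : Complexification N → ℂ) (U : Set (Complexification N)) : Prop :=
  ∀ θ₀ ∈ U, (∀ θ, AnalyticAt ℂ (fun t : ℂ => F (θ₀ + t • θ)) 0) ∧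
    ∃ V ∈ 𝓝 θ₀, ∃ C : ℝ, ∀ θ ∈ V, ‖F θ‖ ≤ C

/-- The class of measures with analytic Laplace transform: on some open neighbourhood of zero,
the integral defining `l_μ` converges and `l_μ` is holomorphic. -/
def HasAnalyticLaplaceTransform (μ : @Measure (StrongDual ℝ N) (cylinderSigma N)) : Prop :=
  ∃ U : Set (Complexification N), IsOpen U ∧ 0 ∈ U ∧
    (∀ θ ∈ U, Integrable (fun x => Complex.exp (complexPairing x θ)) μ) ∧
    IsHolomorphicOn (laplaceTransform μ) U

variable [IsTopologicalAddGroup N]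

/-- The complex-valued linear form `x ↦ ⟨x, θ⟩` on the dual of `N`. -/
def complexPairingLinear (θ : Complexification N) : StrongDual ℝ N →ₗ[ℝ] ℂ where
  toFun x := complexPairing x θ
  map_add' x y := by
    simp only [complexPairing, add_apply, Complex.ofReal_add]; ring
  map_smul' a x := by
    simp only [complexPairing, smul_apply, smul_eq_mul, Complex.ofReal_mul,
      RingHom.id_apply, Complex.real_smul]; ring

theorem sum_complexPairing_sq_le (h : HilbertianNorm N) (F : h.Frame) (θ : Complexification N) :
    ∑ j, ‖complexPairing (h.riesz (F.vec j)) θ‖ ^ 2 ≤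
      h.seminorm θ.1 ^ 2 + h.seminorm θ.2 ^ 2 := by
  have h3 : ∀ a b : ℝ, ‖(a : ℂ) + Complex.I * (b : ℂ)‖ ^ 2 = a ^ 2 + b ^ 2 := fun a b => by
    rw [Complex.sq_norm, Complex.normSq_apply]; simp; ring
  simp only [complexPairing, h3, Finset.sum_add_distrib]
  have key : ∀ ξ : N, ∑ j, (h.riesz (F.vec j) ξ) ^ 2 ≤ h.seminorm ξ ^ 2 := fun ξ => by
    have := F.orthonormal.sum_inner_products_le (h.toCopy ξ : h.Space) (s := Finset.univ)
    rw [Completion.norm_coe] at this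
    simp only [Real.norm_eq_abs, sq_abs] at this
    exact this
  exact add_le_add (key _) (key _)

/-- The symmetric tensor `θ ⊗ ⋯ ⊗ θ` (`n` factors) of the complexification of `N`. -/
def tensorPower (n : ℕ) (θ : Complexification N) : Kernel N n :=
  ⟨(MultilinearMap.mkPiAlgebra ℝ (Fin n) ℂ).compLinearMap fun _ => complexPairingLinear θ, by
    refine ⟨fun σ x => ?_, fun h => ⟨√((h.seminorm θ.1 ^ 2 + h.seminorm θ.2 ^ 2) ^ n), ?_⟩⟩
    · exact Equiv.prod_comp σ fun i => complexPairing (x i) θ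
    · rintro _ ⟨F, rfl⟩
      refine Real.le_sqrt_of_sq_le ?_
      rw [frameNorm_sq]
      have e : ∀ J : Fin n → Fin F.size,
          ‖((MultilinearMap.mkPiAlgebra ℝ (Fin n) ℂ).compLinearMap
            fun _ => complexPairingLinear θ) (fun i => h.riesz (F.vec (J i)))‖ ^ 2 =
          ∏ i, ‖complexPairing (h.riesz (F.vec (J i))) θ‖ ^ 2 := fun J => by
        rw [Finset.prod_pow, ← norm_prod]; rfl
      simp only [e]
      have e2 := (Fintype.prod_sum fun (_ : Fin n) (j : Fin F.size) =>
        ‖complexPairing (h.riesz (F.vec j)) θ‖ ^ 2).symm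
      rw [e2, Finset.prod_const, Finset.card_univ, Fintype.card_fin]
      exact pow_le_pow_left₀ (Finset.sum_nonneg fun _ _ => sq_nonneg _)
        (sum_complexPairing_sq_le h F θ) n⟩

theorem tensorPower_apply (n : ℕ) (θ : Complexification N) (x : Fin n → StrongDual ℝ N) :
    (tensorPower n θ).1 x = ∏ i, complexPairing (x i) θ := rfl

/-- `L` is the `n`-th coefficient `P_n^μ(x)` of the normalized exponential
`e_μ(θ; x) = exp ⟨x, θ⟩ / l_μ(θ) = ∑ₙ (1 / n!) ⟨P_n^μ(x), θ ⊗ ⋯ ⊗ θ⟩`: a continuous linear functional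
on the `n`-th symmetric tensor power whose value at `θ ⊗ ⋯ ⊗ θ` is the `n`-th derivative of
`t ↦ e_μ(t θ; x)` at zero. -/
def IsAppellFunctional (μ : @Measure (StrongDual ℝ N) (cylinderSigma N)) (n : ℕ)
    (x : StrongDual ℝ N) (L : Kernel N n →ₗ[ℂ] ℂ) : Prop :=
  (∃ (h : HilbertianNorm N) (C : ℝ), ∀ A, ‖L A‖ ≤ C * kernelNorm h A) ∧
    ∀ θ : Complexification N, L (tensorPower n θ) =
      iteratedDeriv n
        (fun t : ℂ => Complex.exp (complexPairing x (t • θ)) / laplaceTransform μ (t • θ)) 0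

open Classical in
/-- The functional `φ⁽ⁿ⁾ ↦ ⟨P_n^μ(x), φ⁽ⁿ⁾⟩` on the `n`-th symmetric tensor power, i.e. the unique
continuous linear functional given by the `n`-th Taylor coefficient of `e_μ(·; x)`. -/
def appell (μ : @Measure (StrongDual ℝ N) (cylinderSigma N)) (n : ℕ)
    (x : StrongDual ℝ N) : Kernel N n →ₗ[ℂ] ℂ :=
  if H : ∃ L, IsAppellFunctional μ n x L then H.choose else 0

end Complexification

/-! ### Polynomials on the dual and the test function space -/

section TestFunctions

variable {N : Type*} [AddCommGroup N] [Module ℝ N] [TopologicalSpace N] [IsTopologicalAddGroup N]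

/-- The map which sends a finite sequence `(φ⁽⁰⁾, φ⁽¹⁾, …)` of kernels to the function
`x ↦ ∑ₙ ⟨P_n^μ(x), φ⁽ⁿ⁾⟩` on the dual of `N`. -/
def appellSum (μ : @Measure (StrongDual ℝ N) (cylinderSigma N)) :
    (Π₀ n : ℕ, Kernel N n) →ₗ[ℂ] (StrongDual ℝ N → ℂ) :=
  DFinsupp.lsum ℕ fun n => LinearMap.pi fun x => appell μ n x

/-- The space of smooth polynomials on the dual of `N`: all functions `φ = ∑_{n ≤ m} ⟨P_n^μ, φ⁽ⁿ⁾⟩`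
with `φ⁽ⁿ⁾` in the `n`-th completed symmetric tensor power. (As `⟨P_n^μ(x), φ⁽ⁿ⁾⟩` is
`⟨x ⊗ ⋯ ⊗ x, φ⁽ⁿ⁾⟩` plus terms of lower degree of the same kind, these are exactly the functions
`x ↦ ∑_{n ≤ m} ⟨x ⊗ ⋯ ⊗ x, ψ⁽ⁿ⁾⟩`.) -/
def Polynomials (μ : @Measure (StrongDual ℝ N) (cylinderSigma N)) :
    Submodule ℂ (StrongDual ℝ N → ℂ) :=
  LinearMap.range (appellSum μ)

/-- The weighted norm `(∑ₙ (n!)² 2^{nq} |φ⁽ⁿ⁾|_h²)^{1/2}` of a finite sequence of kernels. (The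
series has finitely many nonzero terms.) -/
def sequenceNorm (h : HilbertianNorm N) (q : ℕ) (c : Π₀ n : ℕ, Kernel N n) : ℝ :=
  √(∑' n : ℕ, (n.factorial : ℝ) ^ 2 * 2 ^ (n * q) * kernelNorm h (c n) ^ 2)

theorem sequenceNorm_nonneg (h : HilbertianNorm N) (q : ℕ) (c : Π₀ n : ℕ, Kernel N n) :
    0 ≤ sequenceNorm h q c := Real.sqrt_nonneg _

theorem kernelNorm_finite_support (h : HilbertianNorm N) (c : Π₀ n : ℕ, Kernel N n) :
    ∃ s : Finset ℕ, ∀ n ∉ s, kernelNorm h (c n) = 0 := by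
  refine ⟨(DFinsupp.finite_support c).toFinset, fun n hn => ?_⟩
  have h0 : c n = 0 := by
    by_contra h1
    exact hn ((Set.Finite.mem_toFinset _).2 h1)
  rw [h0]
  exact map_zero (kernelNorm h)

/-- Minkowski's inequality for weighted sums of squares of finitely many reals. -/
theorem sqrt_tsum_weighted_le (w r a b : ℕ → ℝ) (hw : ∀ n, 0 ≤ w n) (hr : ∀ n, 0 ≤ r n)
    (hrab : ∀ n, r n ≤ a n + b n) (s : Finset ℕ) (hr0 : ∀ n ∉ s, r n = 0) (ha : ∀ n ∉ s, a n = 0)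
    (hb : ∀ n ∉ s, b n = 0) :
    √(∑' n, w n * r n ^ 2) ≤ √(∑' n, w n * a n ^ 2) + √(∑' n, w n * b n ^ 2) := by
  rw [tsum_eq_sum (s := s) fun n hn => by rw [hr0 n hn, zero_pow two_ne_zero, mul_zero],
    tsum_eq_sum (s := s) fun n hn => by rw [ha n hn, zero_pow two_ne_zero, mul_zero],
    tsum_eq_sum (s := s) fun n hn => by rw [hb n hn, zero_pow two_ne_zero, mul_zero]]
  have e : ∀ f : ℕ → ℝ, √(∑ n ∈ s, w n * f n ^ 2) =
      ‖(WithLp.toLp 2 fun n : s => √(w n) * f n : EuclideanSpace ℝ s)‖ := fun f => by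
    rw [EuclideanSpace.norm_eq, ← Finset.sum_coe_sort s]
    simp only [Real.norm_eq_abs, sq_abs, mul_pow, Real.sq_sqrt (hw _)]
  refine (Real.sqrt_le_sqrt (Finset.sum_le_sum fun n _ => mul_le_mul_of_nonneg_left
    (pow_le_pow_left₀ (hr n) (hrab n) 2) (hw n))).trans ?_
  rw [e a, e b, e fun n => a n + b n]
  refine le_trans (le_of_eq (congrArg _ ?_)) (norm_add_le _ _)
  ext n
  simp [mul_add]

theorem sequenceNorm_zero (h : HilbertianNorm N) (q : ℕ) :
    sequenceNorm h q (0 : Π₀ n : ℕ, Kernel N n) = 0 := by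
  simp [sequenceNorm]

theorem sequenceNorm_add_le (h : HilbertianNorm N) (q : ℕ) (c d : Π₀ n : ℕ, Kernel N n) :
    sequenceNorm h q (c + d) ≤ sequenceNorm h q c + sequenceNorm h q d := by
  obtain ⟨s, hs⟩ := kernelNorm_finite_support h c
  obtain ⟨t, ht⟩ := kernelNorm_finite_support h d
  obtain ⟨v, hv⟩ := kernelNorm_finite_support h (c + d)
  refine sqrt_tsum_weighted_le (fun n => (n.factorial : ℝ) ^ 2 * 2 ^ (n * q)) _ _ _
    (fun n => by positivity) (fun n => apply_nonneg _ _) (fun n => map_add_le_add (kernelNorm h) _ _)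
    (s ∪ t ∪ v) (fun n hn => hv n ?_) (fun n hn => hs n ?_) (fun n hn => ht n ?_)
  all_goals simp only [Finset.mem_union, not_or] at hn; tauto

theorem sequenceNorm_smul_le (h : HilbertianNorm N) (q : ℕ) (a : ℂ) (c : Π₀ n : ℕ, Kernel N n) :
    sequenceNorm h q (a • c) ≤ ‖a‖ * sequenceNorm h q c := by
  have e : ∀ n, kernelNorm h ((a • c) n) = ‖a‖ * kernelNorm h (c n) := fun n =>
    map_smul_eq_mul (kernelNorm h) a (c n)
  unfold sequenceNorm
  rw [← Real.sqrt_sq (norm_nonneg a), ← Real.sqrt_mul (sq_nonneg _), ← tsum_mul_left]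
  refine le_of_eq (congrArg _ (tsum_congr fun n => ?_))
  rw [e]
  ring

theorem sequenceNorm_mono {h h' : HilbertianNorm N} (hle : h.seminorm ≤ h'.seminorm) {q q' : ℕ}
    (hq : q ≤ q') (c : Π₀ n : ℕ, Kernel N n) : sequenceNorm h q c ≤ sequenceNorm h' q' c := by
  obtain ⟨s, hs⟩ := kernelNorm_finite_support h c
  obtain ⟨t, ht⟩ := kernelNorm_finite_support h' c
  have hf : ∀ (k : HilbertianNorm N) (l : ℕ) (v : Finset ℕ),
      (∀ n ∉ v, kernelNorm k (c n) = 0) →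
      Summable fun n : ℕ => (n.factorial : ℝ) ^ 2 * 2 ^ (n * l) * kernelNorm k (c n) ^ 2 :=
    fun k l v hv => summable_of_ne_finset_zero (s := v) fun n hn => by
      rw [hv n hn, zero_pow two_ne_zero, mul_zero]
  refine Real.sqrt_le_sqrt ((hf h q s hs).tsum_le_tsum (fun n => ?_) (hf h' q' t ht))
  refine mul_le_mul (mul_le_mul_of_nonneg_left ?_ (sq_nonneg _))
    (pow_le_pow_left₀ (apply_nonneg _ _) (kernelNorm_mono hle _) 2) (sq_nonneg _) (by positivity)
  exact pow_le_pow_right₀ one_le_two (Nat.mul_le_mul_left n hq)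

/-- The norm `‖φ‖_{h,q,μ} = (∑ₙ (n!)² 2^{nq} |φ⁽ⁿ⁾|_h²)^{1/2}` of `φ = ∑ₙ ⟨P_n^μ, φ⁽ⁿ⁾⟩`. (The infimum
over all representations of `φ` is taken; for a measure with analytic Laplace transform
the representation is unique.) -/
def polynomialNorm (μ : @Measure (StrongDual ℝ N) (cylinderSigma N)) (h : HilbertianNorm N)
    (q : ℕ) : Seminorm ℂ (Polynomials μ) :=
  Seminorm.ofSMulLE
    (fun φ => ⨅ c : {c : Π₀ n : ℕ, Kernel N n // appellSum μ c = φ.1}, sequenceNorm h q c.1)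
    (le_antisymm
      (ciInf_le_of_le ⟨0, by rintro _ ⟨c, rfl⟩; exact sequenceNorm_nonneg _ _ _⟩
        ⟨0, map_zero _⟩ (sequenceNorm_zero h q).le)
      (Real.iInf_nonneg fun c => sequenceNorm_nonneg _ _ _))
    (fun φ ψ => by
      have : Nonempty {c : Π₀ n : ℕ, Kernel N n // appellSum μ c = φ.1} := by
        obtain ⟨c, hc⟩ := φ.2; exact ⟨⟨c, hc⟩⟩
      have : Nonempty {c : Π₀ n : ℕ, Kernel N n // appellSum μ c = ψ.1} := by
        obtain ⟨c, hc⟩ := ψ.2; exact ⟨⟨c, hc⟩⟩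
      refine le_ciInf_add_ciInf fun c d => ?_
      refine ciInf_le_of_le ⟨0, by rintro _ ⟨c, rfl⟩; exact sequenceNorm_nonneg _ _ _⟩
        ⟨c.1 + d.1, by rw [map_add, c.2, d.2]; rfl⟩ (sequenceNorm_add_le h q c.1 d.1))
    (fun a φ => by
      have : Nonempty {c : Π₀ n : ℕ, Kernel N n // appellSum μ c = φ.1} := by
        obtain ⟨c, hc⟩ := φ.2; exact ⟨⟨c, hc⟩⟩
      rw [Real.mul_iInf_of_nonneg (norm_nonneg a)]
      refine le_ciInf fun c => ?_
      refine ciInf_le_of_le ⟨0, by rintro _ ⟨c, rfl⟩; exact sequenceNorm_nonneg _ _ _⟩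
        ⟨a • c.1, by rw [map_smul, c.2]; rfl⟩ (sequenceNorm_smul_le h q a c.1))

theorem polynomialNorm_mono (μ : @Measure (StrongDual ℝ N) (cylinderSigma N))
    {h h' : HilbertianNorm N} (hle : h.seminorm ≤ h'.seminorm) {q q' : ℕ} (hq : q ≤ q') :
    polynomialNorm μ h q ≤ polynomialNorm μ h' q' := fun φ => by
  have : Nonempty {c : Π₀ n : ℕ, Kernel N n // appellSum μ c = φ.1} := by
    obtain ⟨c, hc⟩ := φ.2; exact ⟨⟨c, hc⟩⟩
  exact ciInf_mono ⟨0, by rintro _ ⟨c, rfl⟩; exact sequenceNorm_nonneg _ _ _⟩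
    fun c => sequenceNorm_mono hle hq c.1

/-- The Hilbert space `(H_p)^1_{q,μ}`: the completion of the space of polynomials with respect
to `‖·‖_{p,q,μ}`. -/
abbrev HilbertTestSpace (μ : @Measure (StrongDual ℝ N) (cylinderSigma N))
    (𝓗 : HilbertianSystem N) (p q : ℕ) : Type _ :=
  LocalBanach (polynomialNorm μ (𝓗.norm p) q)

/-- The canonical map `(H_{p'})^1_{q',μ} → (H_p)^1_{q,μ}` for `p ≤ p'` and `q ≤ q'`. -/
def linkingMap (μ : @Measure (StrongDual ℝ N) (cylinderSigma N)) (𝓗 : HilbertianSystem N)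
    {p p' q q' : ℕ} (hp : p ≤ p') (hq : q ≤ q') :
    HilbertTestSpace μ 𝓗 p' q' →L[ℂ] HilbertTestSpace μ 𝓗 p q :=
  canonicalMap (polynomialNorm_mono μ (𝓗.mono p p' hp) hq)

/-- The test function space `(N)^1_μ`, the projective limit of the Hilbert spaces `(H_p)^1_{q,μ}`:
the space of all compatible families, with the topology induced by the product topology. -/
def TestSpace (μ : @Measure (StrongDual ℝ N) (cylinderSigma N)) (𝓗 : HilbertianSystem N) :
    Submodule ℂ (∀ i : ℕ × ℕ, HilbertTestSpace μ 𝓗 i.1 i.2) where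
  carrier := {f | ∀ (p p' q q' : ℕ) (hp : p ≤ p') (hq : q ≤ q'),
    linkingMap μ 𝓗 hp hq (f (p', q')) = f (p, q)}
  zero_mem' := fun _ _ _ _ _ _ => map_zero _
  add_mem' := fun {f g} hf hg p p' q q' hp hq => by
    change linkingMap μ 𝓗 hp hq (f (p', q') + g (p', q')) = f (p, q) + g (p, q)
    rw [map_add, hf, hg]
  smul_mem' := fun a f hf p p' q q' hp hq => by
    change linkingMap μ 𝓗 hp hq (a • f (p', q')) = a • f (p, q)
    rw [map_smul, hf]

/-- The canonical map of the space of polynomials into `(N)^1_μ`. -/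
def toTestSpace (μ : @Measure (StrongDual ℝ N) (cylinderSigma N)) (𝓗 : HilbertianSystem N)
    (φ : Polynomials μ) : TestSpace μ 𝓗 :=
  ⟨fun i => toLocalBanach (polynomialNorm μ (𝓗.norm i.1) i.2) φ,
    fun _ _ _ _ _ _ => canonicalMap_toLocalBanach _ φ⟩

end TestFunctions

end

noncomputable section

/-! ### Extension of linear maps and Hilbert-Schmidt domination of seminorms -/

section HilbertSchmidt

variable {𝕜 : Type*} [RCLike 𝕜]

/-! Everything takes place on finite sequences of kernels. The norm of a polynomial is the quotient,
along `appellSum`, of the weighted norm `sequenceNorm`, so both claims reduce to comparing weighted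
norms for different Hilbertian norms and then passing to quotient and completion.

Nuclearity. Since `N` is nuclear, every Hilbertian norm `h` satisfies `|ξ|_h² ≤ ∑ (v i, ξ)²` with
`v` square summable in some `H_k` of the system (`IsNuclearSpace.exists_isHilbertSchmidtSequence`).
Tensoring, `|A|_h²` is at most the sum of the squares of the coefficients of `A` at the tuples `(v
(α 1), …, v (α n))` (`IsHilbertSchmidtSequence.kernelNorm_sq_le`), and such a coefficient is at most
`|A|_k ∏ ‖v (α l)‖`. In degree `n` this costs the factor `(∑ ‖v i‖²)^n`, which a larger `q` turns
into a convergent geometric series; the weighted norms are thus Hilbert-Schmidt dominated by each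
other.

Two Hilbert-Schmidt steps compose to an absolutely convergent expansion. A third one makes its
functionals bounded on a Hilbert space, where an orthogonal projection lets them descend to the
quotient (`NuclearDominated.of_quotient`); this works whatever the kernel of `appellSum` is. Density
of the polynomials carries the expansion over to the projective limit
(`IsNuclearSpace.of_withSeminorms`).

Independence. If `|·|_h ≤ C |·|_k`, then the norms on degree `n` compare with the constant `C^n`,
again absorbed by a larger `q`. Hence the identity on polynomials is continuous in both directions
and extends to mutually inverse maps. -/

/-- A linear map into a Banach space that is bounded by `‖J ·‖`, for a linear map `J` into a Hilbert
space, factors through `J`. -/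
theorem exists_continuousLinearMap_comp_eq {E H Y : Type*} [AddCommGroup E] [Module 𝕜 E]
    [NormedAddCommGroup H] [InnerProductSpace 𝕜 H] [CompleteSpace H]
    [NormedAddCommGroup Y] [NormedSpace 𝕜 Y] [CompleteSpace Y]
    (J : E →ₗ[𝕜] H) (T : E →ₗ[𝕜] Y) {C : ℝ} (hC : 0 ≤ C) (h : ∀ c, ‖T c‖ ≤ C * ‖J c‖) :
    ∃ S : H →L[𝕜] Y, ‖S‖ ≤ C ∧ ∀ c, S (J c) = T c := by
  let K : Submodule 𝕜 H := (LinearMap.range J).topologicalClosure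
  have hJK : ∀ c, J c ∈ K := fun c =>
    (LinearMap.range J).le_topologicalClosure (LinearMap.mem_range_self J c)
  let J' : E →ₗ[𝕜] K := J.codRestrict K hJK
  have hd : DenseRange J' := by
    intro x
    rw [closure_subtype]
    have hx : (x : H) ∈ closure (Set.range J) := x.2
    refine closure_mono ?_ hx
    rintro _ ⟨c, rfl⟩
    exact ⟨J' c, ⟨c, rfl⟩, rfl⟩
  have hJ' : ∀ c, ‖T c‖ ≤ C * ‖J' c‖ := h
  have : CompleteSpace K := (LinearMap.range J).isClosed_topologicalClosure.completeSpace_coe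
  -- Extend by density to the closure of the range, then precompose with the orthogonal projection.
  -- This keeps the bound `C` for values in any Banach space `Y`, where Hahn-Banach would not apply.
  refine ⟨(T.extendOfNorm J').comp K.orthogonalProjectionOnto, ?_, fun c => ?_⟩
  · refine (ContinuousLinearMap.opNorm_comp_le _ _).trans ?_
    calc _ ≤ C * 1 := mul_le_mul (LinearMap.opNorm_extendOfNorm_le hd hC hJ')
          K.orthogonalProjectionOnto_norm_le (norm_nonneg _) hC
      _ = C := mul_one C
  · have e : K.orthogonalProjectionOnto (J c) = J' c :=
      K.orthogonalProjectionOnto_mem_subspace_eq_self (J' c)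
    rw [ContinuousLinearMap.comp_apply, e]
    exact LinearMap.extendOfNorm_eq hd ⟨C, hJ'⟩ c

/-- The map `c ↦ (f i c)_i` into `ℓ²`, for a family of linear functionals that is square summable
at every point. -/
def ellTwoMap {E ι : Type*} [AddCommGroup E] [Module 𝕜 E] (f : ι → E →ₗ[𝕜] 𝕜)
    (hf : ∀ c, Summable fun i => ‖f i c‖ ^ 2) : E →ₗ[𝕜] lp (fun _ : ι => 𝕜) 2 where
  toFun c := ⟨fun i => f i c, memℓp_gen (by simpa using hf c)⟩
  map_add' c d := by ext i; exact map_add (f i) c d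
  map_smul' a c := by ext i; exact map_smul (f i) a c

theorem ellTwoMap_apply {E ι : Type*} [AddCommGroup E] [Module 𝕜 E] (f : ι → E →ₗ[𝕜] 𝕜)
    (hf : ∀ c, Summable fun i => ‖f i c‖ ^ 2) (c : E) (i : ι) : ellTwoMap f hf c i = f i c := rfl

theorem norm_ellTwoMap_sq {E ι : Type*} [AddCommGroup E] [Module 𝕜 E] (f : ι → E →ₗ[𝕜] 𝕜)
    (hf : ∀ c, Summable fun i => ‖f i c‖ ^ 2) (c : E) :
    ‖ellTwoMap f hf c‖ ^ 2 = ∑' i, ‖f i c‖ ^ 2 := by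
  have := lp.norm_rpow_eq_tsum (p := 2) (by norm_num) (ellTwoMap f hf c)
  simpa [ellTwoMap_apply] using this

/-- The seminorm `P` is dominated by a square summable sequence of linear functionals,
the `i`-th of which is bounded by `a i • Q` with `∑ᵢ (a i)² < ∞`. -/
def HilbertSchmidtDominated {E : Type*} [AddCommGroup E] [Module 𝕜 E] (P Q : Seminorm 𝕜 E) :
    Prop :=
  ∃ (ι : Type) (_ : Countable ι) (f : ι → E →ₗ[𝕜] 𝕜) (a : ι → ℝ), (∀ i, 0 ≤ a i) ∧
    Summable (fun i => a i ^ 2) ∧ (∀ i c, ‖f i c‖ ≤ a i * Q c) ∧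
      ∀ c, P c ^ 2 ≤ ∑' i, ‖f i c‖ ^ 2

theorem summable_sq_of_le {E ι : Type*} [AddCommGroup E] [Module 𝕜 E] {f : ι → E →ₗ[𝕜] 𝕜}
    {a : ι → ℝ} (ha : Summable fun i => a i ^ 2) {c : E} {r : ℝ} (h : ∀ i, ‖f i c‖ ≤ a i * r) :
    Summable fun i => ‖f i c‖ ^ 2 :=
  (ha.mul_right (r ^ 2)).of_nonneg_of_le (fun i => sq_nonneg _) fun i => by
    rw [← mul_pow]; exact pow_le_pow_left₀ (norm_nonneg _) (h i) 2

theorem norm_ellTwoMap_le {E ι : Type*} [AddCommGroup E] [Module 𝕜 E] {f : ι → E →ₗ[𝕜] 𝕜}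
    (hf : ∀ c, Summable fun i => ‖f i c‖ ^ 2)
    {a : ι → ℝ} (ha : Summable fun i => a i ^ 2) {c : E} {r : ℝ} (hr : 0 ≤ r)
    (h : ∀ i, ‖f i c‖ ≤ a i * r) :
    ‖ellTwoMap f hf c‖ ≤ √(∑' i, a i ^ 2) * r := by
  have h0 : 0 ≤ ∑' i, a i ^ 2 := tsum_nonneg fun i => sq_nonneg _
  refine (sq_le_sq₀ (norm_nonneg _) (by positivity)).1 ?_
  rw [norm_ellTwoMap_sq, mul_pow, Real.sq_sqrt h0, ← tsum_mul_right]
  refine (hf c).tsum_le_tsum (fun i => ?_) (ha.mul_right _)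
  rw [← mul_pow]; exact pow_le_pow_left₀ (norm_nonneg _) (h i) 2

/-- A map that factors through two consecutive Hilbert-Schmidt maps has an expansion with square
summable vectors. -/
theorem exists_hasSum_of_hilbertSchmidt {E Y ι κ : Type*} [AddCommGroup E] [Module 𝕜 E]
    [NormedAddCommGroup Y] [NormedSpace 𝕜 Y] [CompleteSpace Y] (T : E →ₗ[𝕜] Y)
    (f : ι → E →ₗ[𝕜] 𝕜) (hf : ∀ c, Summable fun i => ‖f i c‖ ^ 2)
    (g : κ → E →ₗ[𝕜] 𝕜) (hg : ∀ c, Summable fun i => ‖g i c‖ ^ 2)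
    (hT : ∀ c, ‖T c‖ ≤ ‖ellTwoMap f hf c‖) {a : ι → ℝ} (ha0 : ∀ i, 0 ≤ a i)
    (ha : Summable fun i => a i ^ 2) (hfg : ∀ i c, ‖f i c‖ ≤ a i * ‖ellTwoMap g hg c‖) :
    ∃ z : κ → Y, Summable (fun k => ‖z k‖ ^ 2) ∧ ∀ c, HasSum (fun k => g k c • z k) (T c) := by
  obtain ⟨S, -, hS⟩ := exists_continuousLinearMap_comp_eq (ellTwoMap f hf) T zero_le_one
    (fun c => by rw [one_mul]; exact hT c)
  choose w hw hwg using fun i =>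
    exists_continuousLinearMap_comp_eq (ellTwoMap g hg) (f i) (ha0 i) (hfg i)
  have hwv : ∀ (v : lp (fun _ : κ => 𝕜) 2) i, ‖(w i : lp (fun _ : κ => 𝕜) 2 →ₗ[𝕜] 𝕜) v‖ ≤
      a i * ‖v‖ := fun v i => (w i).le_of_opNorm_le (hw i) v
  have hws : ∀ v, Summable fun i => ‖w i v‖ ^ 2 := fun v => summable_sq_of_le (f := fun i => (w i : lp (fun _ : κ => 𝕜) 2 →ₗ[𝕜] 𝕜))
    ha (hwv v)
  -- `D` is the Hilbert-Schmidt link in the factorization `T = S ∘ D ∘ ellTwoMap g`: its `i`-th row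
  -- `w i` has norm at most `a i`.
  let D : lp (fun _ : κ => 𝕜) 2 →L[𝕜] lp (fun _ : ι => 𝕜) 2 :=
    (ellTwoMap (fun i => (w i : lp (fun _ : κ => 𝕜) 2 →ₗ[𝕜] 𝕜)) hws).mkContinuous _ fun v => norm_ellTwoMap_le hws ha (norm_nonneg v) (hwv v)
  have hD : ∀ c, D (ellTwoMap g hg c) = ellTwoMap f hf c := fun c => by
    ext i; exact hwg i c
  have hDn : ∀ v, ‖D v‖ ^ 2 = ∑' i, ‖w i v‖ ^ 2 := fun v => norm_ellTwoMap_sq _ hws v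
  let b : HilbertBasis κ 𝕜 (lp (fun _ : κ => 𝕜) 2) :=
    HilbertBasis.ofRepr (LinearIsometryEquiv.refl 𝕜 _)
  refine ⟨fun k => S (D (b k)), ?_, fun c => ?_⟩
  · have key : Summable fun k => ‖D (b k)‖ ^ 2 := by
      refine summable_of_sum_le (c := ∑' i, a i ^ 2) (fun k => sq_nonneg _) fun u => ?_
      simp only [hDn]
      rw [← Summable.tsum_finsetSum fun k _ => hws (b k)]
      refine (summable_sum fun k _ => hws (b k)).tsum_le_tsum (fun i => ?_) ha
      -- Bessel's inequality for the Riesz vector of `w i` bounds the `i`-th row of the matrix of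
      -- `D`. Interchanging rows and columns makes the vectors `D (b k)` square summable.
      have h1 := b.orthonormal.sum_inner_products_le
        ((InnerProductSpace.toDual 𝕜 _).symm (w i)) (s := u)
      rw [LinearIsometryEquiv.norm_map] at h1
      refine le_trans (Finset.sum_le_sum fun k _ => ?_)
        (h1.trans (pow_le_pow_left₀ (norm_nonneg _) (hw i) 2))
      rw [← InnerProductSpace.toDual_symm_apply (𝕜 := 𝕜) (y := w i), norm_inner_symm]
    refine (key.mul_left (‖S‖ ^ 2)).of_nonneg_of_le (fun _ => sq_nonneg _) fun k => ?_
    rw [← mul_pow]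
    exact pow_le_pow_left₀ (norm_nonneg _) (S.le_opNorm _) 2
  -- The coordinates of `ellTwoMap g hg c` in the standard basis are the numbers `g k c`, so
  -- applying `S ∘ D` to its basis expansion gives the claim.
  · have h1 := (b.hasSum_repr (ellTwoMap g hg c)).mapL (S.comp D)
    simp only [ContinuousLinearMap.comp_apply, map_smul, hD, hS] at h1
    exact h1

/-- A family of rank one operators with summable norms defines a bounded operator. -/
theorem exists_continuousLinearMap_hasSum {X Y κ : Type*} [NormedAddCommGroup X] [NormedSpace 𝕜 X]
    [NormedAddCommGroup Y] [NormedSpace 𝕜 Y] [CompleteSpace Y] (w : κ → StrongDual 𝕜 X)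
    (z : κ → Y) (h : Summable fun k => ‖w k‖ * ‖z k‖) :
    ∃ Θ : X →L[𝕜] Y, ∀ v, HasSum (fun k => w k v • z k) (Θ v) := by
  have hs : Summable fun k => (w k).smulRight (z k) := by
    refine Summable.of_norm ?_
    simpa only [ContinuousLinearMap.norm_smulRight_apply] using h
  refine ⟨∑' k, (w k).smulRight (z k), fun v => ?_⟩
  exact hs.hasSum.mapL (ContinuousLinearMap.apply 𝕜 Y v)

/-! ### Nuclear expansions on quotient spaces -/

/-- An expansion in functionals that are bounded by a Hilbertian seminorm descends to
a quotient space. -/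
theorem exists_hasSum_quotient {E V H Y κ : Type*} [AddCommGroup E] [Module 𝕜 E]
    [AddCommGroup V] [Module 𝕜 V] [NormedAddCommGroup H] [InnerProductSpace 𝕜 H] [CompleteSpace H]
    [NormedAddCommGroup Y] [NormedSpace 𝕜 Y] [CompleteSpace Y]
    (s : E →ₗ[𝕜] V) (hs : Function.Surjective s) (J : E →ₗ[𝕜] H) (T : V →ₗ[𝕜] Y)
    (g : κ → E →ₗ[𝕜] 𝕜) (z : κ → Y) {b : κ → ℝ} (hb : ∀ k, 0 ≤ b k)
    (hg : ∀ k c, ‖g k c‖ ≤ b k * ‖J c‖) (hbz : Summable fun k => b k * ‖z k‖)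
    (hT : ∀ c, HasSum (fun k => g k c • z k) (T (s c))) :
    ∃ f : κ → V →ₗ[𝕜] 𝕜, (∀ k c, ‖f k (s c)‖ ≤ b k * ‖J c‖) ∧
      ∀ φ, HasSum (fun k => f k φ • z k) (T φ) := by
  choose w hw hwg using fun k => exists_continuousLinearMap_comp_eq J (g k) (hb k) (hg k)
  obtain ⟨Θ, hΘ⟩ := exists_continuousLinearMap_hasSum w z
    (hbz.of_nonneg_of_le (fun k => by positivity)
      fun k => mul_le_mul_of_nonneg_right (hw k) (norm_nonneg _))
  have hΘJ : ∀ c, Θ (J c) = T (s c) := fun c => by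
    refine (hΘ (J c)).unique ?_
    simpa only [hwg] using hT c
  -- The sum `Θ` vanishes on `K`, but a single `w k` need not. Composing each `w k` with the
  -- projection onto `Kᗮ` leaves `Θ` unchanged and makes the value at `J c` depend on `s c` only.
  let K : Submodule 𝕜 H := ((LinearMap.ker s).map J).topologicalClosure
  have hK : IsClosed (K : Set H) := Submodule.isClosed_topologicalClosure _
  have : CompleteSpace K := hK.completeSpace_coe
  have hJK : ∀ c, s c = 0 → J c ∈ K := fun c hc =>
    Submodule.le_topologicalClosure _ (Submodule.mem_map_of_mem hc)
  have hKΘ : ∀ v ∈ K, Θ v = 0 := by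
    have : K ≤ LinearMap.ker (Θ : H →ₗ[𝕜] Y) := by
      refine Submodule.topologicalClosure_minimal _ ?_ Θ.isClosed_ker
      rintro _ ⟨c, hc, rfl⟩
      change Θ (J c) = 0
      rw [hΘJ, LinearMap.mem_ker.1 hc, map_zero]
    exact fun v hv => this hv
  have hπ : ∀ c d, s c = s d → Kᗮ.starProjection (J c) = Kᗮ.starProjection (J d) := by
    intro c d hcd
    rw [← sub_eq_zero, ← map_sub, ← map_sub, Submodule.starProjection_apply_eq_zero_iff]
    exact K.le_orthogonal_orthogonal (hJK _ (by rw [map_sub, hcd, sub_self]))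
  have hΘπ : ∀ v, Θ (Kᗮ.starProjection v) = Θ v := by
    intro v
    rw [← sub_eq_zero, ← map_sub]
    have e : v - Kᗮ.starProjection v ∈ K := by
      have := Kᗮ.sub_starProjection_mem_orthogonal v
      rwa [Submodule.orthogonal_orthogonal] at this
    rw [← neg_sub, map_neg, hKΘ _ e, neg_zero]
  -- A purely algebraic section suffices: by `hπ`, the projected vector does not depend on the lift,
  -- so no bound on `r` is needed.
  obtain ⟨r, hr⟩ := s.exists_rightInverse_of_surjective (LinearMap.range_eq_top.2 hs)
  have hr' : ∀ φ, s (r φ) = φ := fun φ => LinearMap.congr_fun hr φ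
  refine ⟨fun k => ((w k).comp Kᗮ.starProjection : H →ₗ[𝕜] 𝕜) ∘ₗ J ∘ₗ r, fun k c => ?_,
    fun φ => ?_⟩
  · change ‖w k (Kᗮ.starProjection (J (r (s c))))‖ ≤ _
    rw [hπ _ c (hr' _)]
    refine ((w k).le_of_opNorm_le (hw k) _).trans (mul_le_mul_of_nonneg_left ?_ (hb k))
    simpa using Kᗮ.starProjection.le_of_opNorm_le Kᗮ.starProjection_norm_le (J c)
  · have := hΘ (Kᗮ.starProjection (J (r φ)))
    rw [hΘπ, hΘJ, hr'] at this
    exact this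

/-- The canonical map of `V` into its completion with respect to `p`. -/
def toLocalBanachLinear {V : Type*} [AddCommGroup V] [Module 𝕜 V] (p : Seminorm 𝕜 V) :
    V →ₗ[𝕜] LocalBanach p where
  toFun := toLocalBanach p
  map_add' v w := Completion.coe_add (α := SeminormedCopy p) v w
  map_smul' a v := Completion.coe_smul (X := SeminormedCopy p) a v

theorem toLocalBanachLinear_apply {V : Type*} [AddCommGroup V] [Module 𝕜 V] (p : Seminorm 𝕜 V)
    (v : V) : toLocalBanachLinear p v = toLocalBanach p v := rfl

theorem norm_toLocalBanach {V : Type*} [AddCommGroup V] [Module 𝕜 V] (p : Seminorm 𝕜 V) (v : V) :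
    ‖toLocalBanach p v‖ = p v := Completion.norm_coe (E := SeminormedCopy p) v

theorem norm_toLocalBanachLinear {V : Type*} [AddCommGroup V] [Module 𝕜 V] (p : Seminorm 𝕜 V)
    (v : V) : ‖toLocalBanachLinear p v‖ = p v := norm_toLocalBanach p v

theorem denseRange_toLocalBanach {V : Type*} [AddCommGroup V] [Module 𝕜 V] (p : Seminorm 𝕜 V) :
    DenseRange (toLocalBanach p) := Completion.denseRange_coe (α := SeminormedCopy p)

theorem denseRange_toLocalBanachLinear {V : Type*} [AddCommGroup V] [Module 𝕜 V]
    (p : Seminorm 𝕜 V) : DenseRange (toLocalBanachLinear p) := denseRange_toLocalBanach p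

/-- The canonical image of `V` in the completion of `(V, P)` has an absolutely convergent expansion
in functionals that are bounded with respect to `Q`. -/
def NuclearDominated {V : Type*} [AddCommGroup V] [Module 𝕜 V] (P Q : Seminorm 𝕜 V) : Prop :=
  ∃ (f : ℕ → V →ₗ[𝕜] 𝕜) (y : ℕ → LocalBanach P) (a : ℕ → ℝ), (∀ n, 0 ≤ a n) ∧
    Summable (fun n => a n * ‖y n‖) ∧ (∀ n φ, ‖f n φ‖ ≤ a n * Q φ) ∧
      ∀ φ, HasSum (fun n => f n φ • y n) (toLocalBanach P φ)

/-- Three consecutive Hilbert-Schmidt dominations of seminorms give a nuclear domination of their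
quotient seminorms. -/
theorem NuclearDominated.of_quotient {E V : Type*} [AddCommGroup E] [Module 𝕜 E]
    [AddCommGroup V] [Module 𝕜 V] (s : E →ₗ[𝕜] V) (hs : Function.Surjective s)
    {P R Q Q' : Seminorm 𝕜 E} (hPR : HilbertSchmidtDominated P R)
    (hRQ : HilbertSchmidtDominated R Q) (hQQ' : HilbertSchmidtDominated Q Q')
    {P₀ Q₀ : Seminorm 𝕜 V} (hP₀ : ∀ c, P₀ (s c) ≤ P c)
    (hQ₀ : ∀ φ, ∀ ε > 0, ∃ c, s c = φ ∧ Q' c ≤ Q₀ φ + ε) : NuclearDominated P₀ Q₀ := by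
  obtain ⟨ι₁, -, f₁, a₁, ha₁, hs₁, hb₁, hd₁⟩ := hPR
  obtain ⟨ι₂, hι₂, f₂, a₂, ha₂, hs₂, hb₂, hd₂⟩ := hRQ
  obtain ⟨ι₃, -, f₃, a₃, ha₃, hs₃, hb₃, hd₃⟩ := hQQ'
  have hf₁ := fun c => summable_sq_of_le hs₁ fun i => hb₁ i c
  have hf₂ := fun c => summable_sq_of_le hs₂ fun i => hb₂ i c
  have hf₃ := fun c => summable_sq_of_le hs₃ fun i => hb₃ i c
  have hP : ∀ c, P c ≤ ‖ellTwoMap f₁ hf₁ c‖ := fun c =>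
    (sq_le_sq₀ (apply_nonneg P c) (norm_nonneg _)).1 (by rw [norm_ellTwoMap_sq]; exact hd₁ c)
  have hR : ∀ c, R c ≤ ‖ellTwoMap f₂ hf₂ c‖ := fun c =>
    (sq_le_sq₀ (apply_nonneg R c) (norm_nonneg _)).1 (by rw [norm_ellTwoMap_sq]; exact hd₂ c)
  have hQ : ∀ c, Q c ≤ ‖ellTwoMap f₃ hf₃ c‖ := fun c =>
    (sq_le_sq₀ (apply_nonneg Q c) (norm_nonneg _)).1 (by rw [norm_ellTwoMap_sq]; exact hd₃ c)
  obtain ⟨z, hz, hTz⟩ := exists_hasSum_of_hilbertSchmidt (toLocalBanachLinear P₀ ∘ₗ s) f₁ hf₁ f₂ hf₂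
    (fun c => by
      rw [LinearMap.comp_apply, norm_toLocalBanachLinear]; exact (hP₀ c).trans (hP c)) ha₁ hs₁
    (fun i c => (hb₁ i c).trans (mul_le_mul_of_nonneg_left (hR c) (ha₁ i)))
  -- Both factors are square summable, so their product is summable.
  have haz : Summable fun k => a₂ k * ‖z k‖ :=
    (hs₂.add hz).of_nonneg_of_le (fun k => mul_nonneg (ha₂ k) (norm_nonneg _)) fun k => by
      nlinarith [sq_nonneg (a₂ k - ‖z k‖), sq_nonneg (a₂ k), sq_nonneg ‖z k‖]
  -- The third domination supplies the Hilbert space for the descent; the expansion itself came from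
  -- the first two.
  obtain ⟨f, hfb, hfs⟩ := exists_hasSum_quotient s hs (ellTwoMap f₃ hf₃) (toLocalBanachLinear P₀)
    f₂ z ha₂ (fun k c => (hb₂ k c).trans (mul_le_mul_of_nonneg_left (hQ c) (ha₂ k))) haz hTz
  set C := √(∑' i, a₃ i ^ 2) with hC
  have hC0 : 0 ≤ C := Real.sqrt_nonneg _
  have hfQ : ∀ k φ, ‖f k φ‖ ≤ a₂ k * C * Q₀ φ := by
    intro k φ
    refine le_of_forall_pos_le_add fun ε hε => ?_
    have hA : 0 ≤ a₂ k * C := mul_nonneg (ha₂ k) hC0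
    -- The quotient seminorm is approached by lifts up to any error. The summand `1` keeps the
    -- quotient meaningful when `a₂ k * C = 0`.
    obtain ⟨c, rfl, hc⟩ := hQ₀ φ (ε / (a₂ k * C + 1)) (by positivity)
    have h1 : ‖f k (s c)‖ ≤ a₂ k * (C * Q' c) := (hfb k c).trans
      (mul_le_mul_of_nonneg_left (norm_ellTwoMap_le hf₃ hs₃ (apply_nonneg Q' c)
        fun i => hb₃ i c) (ha₂ k))
    have h2 : a₂ k * C * (ε / (a₂ k * C + 1)) ≤ ε := by
      rw [← mul_div_assoc, div_le_iff₀ (by positivity)]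
      nlinarith
    calc _ ≤ a₂ k * C * Q' c := by rw [mul_assoc]; exact h1
      _ ≤ a₂ k * C * (Q₀ (s c) + ε / (a₂ k * C + 1)) := mul_le_mul_of_nonneg_left hc hA
      _ ≤ _ := by rw [mul_add]; gcongr
  -- Reindex the countable family by `ℕ`, with zeros off the range of `e`.
  obtain ⟨e, he⟩ := hι₂.exists_injective_nat
  refine ⟨Function.extend e f 0, Function.extend e z 0, Function.extend e (fun k => a₂ k * C) 0,
    fun n => ?_, ?_, fun n φ => ?_, fun φ => ?_⟩
  · by_cases hn : ∃ k, e k = n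
    · obtain ⟨k, rfl⟩ := hn
      rw [he.extend_apply]; exact mul_nonneg (ha₂ k) hC0
    · rw [Function.extend_apply' _ _ _ hn]; exact le_rfl
  · refine (he.summable_iff fun n hn => ?_).1 ?_
    · rw [Function.extend_apply' _ _ _ hn]; simp
    · refine (haz.mul_left C).congr fun k => ?_
      simp only [Function.comp_apply, he.extend_apply]; ring
  · by_cases hn : ∃ k, e k = n
    · obtain ⟨k, rfl⟩ := hn
      rw [he.extend_apply, he.extend_apply]; exact hfQ k φ
    · rw [Function.extend_apply' _ _ _ hn, Function.extend_apply' _ _ _ hn]; simp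
  · refine (he.hasSum_iff fun n hn => ?_).1 ?_
    · rw [Function.extend_apply' _ _ _ hn]; simp
    · refine (hfs φ).congr_fun fun k => ?_
      simp only [Function.comp_apply, he.extend_apply]

end HilbertSchmidt

/-! ### Hilbert-Schmidt domination of the norms of kernels -/

section KernelBounds

/-- A continuous seminorm is bounded by one member of a directed system of seminorms which defines
the topology. -/
theorem WithSeminorms.exists_le_smul {𝕜 E ι : Type*} [RCLike 𝕜] [AddCommGroup E] [Module 𝕜 E]
    [TopologicalSpace E] [Preorder ι] [IsDirectedOrder ι] [Nonempty ι] {ρ : ι → Seminorm 𝕜 E}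
    (hρ : WithSeminorms ρ) (hmono : Monotone ρ) (p : Seminorm 𝕜 E) (hp : Continuous p) :
    ∃ (i : ι) (C : ℝ), 0 ≤ C ∧ ∀ x, p x ≤ C * ρ i x := by
  obtain ⟨s, C, -, h⟩ := Seminorm.bound_of_continuous hρ p hp
  obtain ⟨i, hi⟩ := s.exists_le
  refine ⟨i, C, C.2, fun x => (h x).trans ?_⟩
  change (C : ℝ) * s.sup ρ x ≤ _
  exact mul_le_mul_of_nonneg_left (Finset.sup_le (fun j hj => hmono (hi j hj)) x) C.2

/-- Every finite set of multi-indices lies in a box, and over a box the sum of products factors into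
a product of `n` finite sums. -/
theorem summable_prod_pi {c : ℕ → ℝ} (hc0 : ∀ i, 0 ≤ c i) (hc : Summable c) (n : ℕ) :
    Summable (fun α : Fin n → ℕ => ∏ i, c (α i)) ∧
      ∑' α : Fin n → ℕ, ∏ i, c (α i) ≤ (∑' i, c i) ^ n := by
  have key : ∀ u : Finset (Fin n → ℕ), ∑ α ∈ u, ∏ i, c (α i) ≤ (∑' i, c i) ^ n := by
    intro u
    let t : Fin n → Finset ℕ := fun i => u.image fun α => α i
    calc ∑ α ∈ u, ∏ i, c (α i) ≤ ∑ α ∈ Fintype.piFinset t, ∏ i, c (α i) :=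
          Finset.sum_le_sum_of_subset_of_nonneg
            (fun α hα => Fintype.mem_piFinset.2 fun i => Finset.mem_image_of_mem _ hα)
            fun α _ _ => Finset.prod_nonneg fun i _ => hc0 _
      _ = ∏ i, ∑ j ∈ t i, c j := (Finset.prod_univ_sum t fun _ j => c j).symm
      _ ≤ ∏ _i : Fin n, ∑' j, c j := Finset.prod_le_prod
            (fun i _ => Finset.sum_nonneg fun j _ => hc0 j)
            fun i _ => hc.sum_le_tsum _ fun j _ => hc0 j
      _ = (∑' i, c i) ^ n := by rw [Finset.prod_const, Finset.card_univ, Fintype.card_fin]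
  have h0 : ∀ α : Fin n → ℕ, 0 ≤ ∏ i, c (α i) := fun α => Finset.prod_nonneg fun i _ => hc0 _
  have hs := summable_of_sum_le h0 key
  exact ⟨hs, hs.tsum_le_of_sum_le key⟩

variable {N : Type*} [AddCommGroup N] [Module ℝ N] [TopologicalSpace N]

namespace HilbertianNorm

/-- The canonical map of `N` into its completion with respect to `h`. -/
def toSpace (h : HilbertianNorm N) : N →ₗ[ℝ] h.Space where
  toFun ξ := (h.toCopy ξ : h.Space)
  map_add' ξ η := by rw [map_add, Completion.coe_add]
  map_smul' a ξ := by rw [map_smul, Completion.coe_smul]; rfl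

theorem norm_toSpace (h : HilbertianNorm N) (ξ : N) : ‖h.toSpace ξ‖ = h.seminorm ξ :=
  Completion.norm_coe (h.toCopy ξ)

variable [IsTopologicalAddGroup N]

/-- The identification of `H_h` with a subspace of the dual of `N`, as a linear map. -/
def rieszLinear (h : HilbertianNorm N) : h.Space →ₗ[ℝ] StrongDual ℝ N where
  toFun := h.riesz
  map_add' x y := by ext ξ; exact inner_add_left x y (h.toCopy ξ : h.Space)
  map_smul' a x := by ext ξ; exact real_inner_smul_left x (h.toCopy ξ : h.Space) a

theorem rieszLinear_apply (h : HilbertianNorm N) (v : h.Space) : h.rieszLinear v = h.riesz v := rfl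

theorem riesz_apply (h : HilbertianNorm N) (v : h.Space) (ξ : N) :
    h.riesz v ξ = inner ℝ v (h.toCopy ξ : h.Space) := rfl

/-- Riesz representation: a linear functional on `N` that is bounded by `h` comes from `H_h`. -/
theorem exists_riesz_eq (h : HilbertianNorm N) (f : N →ₗ[ℝ] ℝ) {C : ℝ} (hC : 0 ≤ C)
    (hf : ∀ ξ, |f ξ| ≤ C * h.seminorm ξ) : ∃ v : h.Space, ‖v‖ ≤ C ∧ ∀ ξ, h.riesz v ξ = f ξ := by
  obtain ⟨S, hSC, hS⟩ := exists_continuousLinearMap_comp_eq h.toSpace f hC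
    (fun ξ => by rw [norm_toSpace]; exact hf ξ)
  refine ⟨(InnerProductSpace.toDual ℝ h.Space).symm S, ?_, fun ξ => ?_⟩
  · rwa [LinearIsometryEquiv.norm_map]
  · rw [riesz_apply, InnerProductSpace.toDual_symm_apply]; exact hS ξ

end HilbertianNorm

variable [IsTopologicalAddGroup N]

/-! ### Coefficients of kernels along Hilbert-Schmidt sequences -/

/-- A Hilbert-Schmidt form is bounded by the product of the norms of its arguments. -/
theorem norm_kernel_riesz_le {n : ℕ} (h : HilbertianNorm N) (A : Kernel N n)
    (v : Fin n → h.Space) :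
    ‖A.1 fun i => h.riesz (v i)‖ ≤ kernelNorm h A * ∏ i, ‖v i‖ := by
  -- In an orthonormal basis of the span of the arguments, the bound is the Cauchy-Schwarz
  -- inequality: the coefficients of the tensor of the `v i` have square sum `∏ i, ‖v i‖ ^ 2`, and
  -- the basis is itself a frame.
  let S : Submodule ℝ h.Space := Submodule.span ℝ (Set.range v)
  have : FiniteDimensional ℝ S := FiniteDimensional.span_of_finite ℝ (Set.finite_range v)
  let b := stdOrthonormalBasis ℝ S
  let u : Fin (Module.finrank ℝ S) → h.Space := fun l => (b l : h.Space)
  have hu : Orthonormal ℝ u := b.orthonormal.comp_linearIsometry S.subtypeₗᵢ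
  let F : h.Frame := ⟨_, u, hu⟩
  let T : Fin n → Fin (Module.finrank ℝ S) → ℝ := fun j l => inner ℝ (u l) (v j)
  have hvu : ∀ j, v j = ∑ l, T j l • u l := by
    intro j
    have hgS : v j ∈ S := Submodule.subset_span ⟨j, rfl⟩
    have := congrArg (Subtype.val) (b.sum_repr' ⟨v j, hgS⟩)
    simp only [Submodule.coe_sum, Submodule.coe_smul, Submodule.coe_inner] at this
    exact this.symm
  have hT : ∀ j, ∑ l, T j l ^ 2 = ‖v j‖ ^ 2 := by
    intro j
    have := hu.inner_sum (T j) (T j) Finset.univ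
    rw [← hvu, real_inner_self_eq_norm_sq] at this
    rw [this]
    exact Finset.sum_congr rfl fun l _ => by simp [sq]
  have hA : A.1 (fun i => h.riesz (v i)) =
      ∑ J : Fin n → Fin (Module.finrank ℝ S), (∏ i, T i (J i)) • A.1 fun i => h.riesz (u (J i)) := by
    have e : (fun i => h.riesz (v i)) = fun i => ∑ l, T i l • h.riesz (u l) := by
      funext i
      simp only [← h.rieszLinear_apply]
      conv_lhs => rw [hvu i]
      rw [map_sum]
      simp only [map_smul]
    rw [e, MultilinearMap.map_sum]
    exact Finset.sum_congr rfl fun J _ => A.1.map_smul_univ _ _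
  have hF : frameNorm h A.1 F ≤ kernelNorm h A := le_ciSup (A.2.2 h) F
  refine (sq_le_sq₀ (norm_nonneg _) (mul_nonneg (apply_nonneg _ _)
    (Finset.prod_nonneg fun i _ => norm_nonneg _))).1 ?_
  calc ‖A.1 fun i => h.riesz (v i)‖ ^ 2
      ≤ (∑ J : Fin n → Fin (Module.finrank ℝ S),
          |∏ i, T i (J i)| * ‖A.1 fun i => h.riesz (u (J i))‖) ^ 2 := by
        refine pow_le_pow_left₀ (norm_nonneg _) ?_ 2
        rw [hA]
        refine (norm_sum_le _ _).trans (le_of_eq (Finset.sum_congr rfl fun J _ => ?_))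
        rw [norm_smul, Real.norm_eq_abs]
    _ ≤ (∑ J : Fin n → Fin (Module.finrank ℝ S), |∏ i, T i (J i)| ^ 2) *
          ∑ J : Fin n → Fin (Module.finrank ℝ S), ‖A.1 fun i => h.riesz (u (J i))‖ ^ 2 :=
        Finset.sum_mul_sq_le_sq_mul_sq _ _ _
    _ = (∏ i, ‖v i‖ ^ 2) * frameNorm h A.1 F ^ 2 := by
        rw [frameNorm_sq]
        congr 1
        simp only [sq_abs, ← Finset.prod_pow, ← hT]
        exact (Fintype.prod_sum fun i l => T i l ^ 2).symm
    _ ≤ (∏ i, ‖v i‖ ^ 2) * kernelNorm h A ^ 2 := by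
        refine mul_le_mul_of_nonneg_left (pow_le_pow_left₀ (frameNorm_nonneg _ _ _) hF 2) ?_
        exact Finset.prod_nonneg fun i _ => sq_nonneg _
    _ = _ := by rw [mul_pow, Finset.prod_pow, mul_comm]

/-- A sequence in `H_{h'}` that is square summable and dominates `h` in the sense
of Hilbert and Schmidt. -/
structure IsHilbertSchmidtSequence (h h' : HilbertianNorm N) (v : ℕ → h'.Space) : Prop where
  summable : Summable fun i => ‖v i‖ ^ 2
  sq_le : ∀ ξ, h.seminorm ξ ^ 2 ≤ ∑' i, (h'.riesz (v i) ξ) ^ 2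

theorem norm_riesz_apply_le (h : HilbertianNorm N) (v : h.Space) (ξ : N) :
    |h.riesz v ξ| ≤ ‖v‖ * h.seminorm ξ := by
  rw [← h.norm_toSpace]; exact abs_real_inner_le_norm v (h.toSpace ξ)

namespace IsHilbertSchmidtSequence

variable {h h' : HilbertianNorm N} {v : ℕ → h'.Space}

theorem summable_norm_kernel_sq (hv : IsHilbertSchmidtSequence h h' v) {n : ℕ} (A : Kernel N n) :
    Summable fun α : Fin n → ℕ => ‖A.1 fun i => h'.riesz (v (α i))‖ ^ 2 := by
  refine ((summable_prod_pi (fun i => sq_nonneg _) hv.summable n).1.mul_left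
    (kernelNorm h' A ^ 2)).of_nonneg_of_le (fun _ => sq_nonneg _) fun α => ?_
  rw [Finset.prod_pow, ← mul_pow]
  exact pow_le_pow_left₀ (norm_nonneg _) (norm_kernel_riesz_le h' A _) 2

/-- The square of the norm `|A|_h` of a kernel is dominated by the sum of the squares of
the coefficients of `A` with respect to a Hilbert-Schmidt sequence. -/
theorem kernelNorm_sq_le (hv : IsHilbertSchmidtSequence h h' v) {n : ℕ} (A : Kernel N n) :
    kernelNorm h A ^ 2 ≤ ∑' α : Fin n → ℕ, ‖A.1 fun i => h'.riesz (v (α i))‖ ^ 2 := by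
  have hsum : ∀ ξ, Summable fun i => ‖(h'.riesz (v i) : N →ₗ[ℝ] ℝ) ξ‖ ^ 2 := fun ξ =>
    summable_sq_of_le hv.summable fun i => norm_riesz_apply_le h' (v i) ξ
  -- By `sq_le`, the map `ξ ↦ (v i, ξ)_i` into `ℓ²` dominates `h`, so the embedding of `N` into
  -- `H_h` factors through it by a contraction `S`.
  obtain ⟨S, hS1, hS⟩ := exists_continuousLinearMap_comp_eq (ellTwoMap _ hsum) h.toSpace zero_le_one
    (fun ξ => by
      rw [one_mul, h.norm_toSpace]
      refine (sq_le_sq₀ (apply_nonneg _ _) (norm_nonneg _)).1 ?_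
      rw [norm_ellTwoMap_sq]
      simpa using hv.sq_le ξ)
  let b : HilbertBasis ℕ ℝ (lp (fun _ : ℕ => ℝ) 2) :=
    HilbertBasis.ofRepr (LinearIsometryEquiv.refl ℝ _)
  have h0 : 0 ≤ ∑' α : Fin n → ℕ, ‖A.1 fun i => h'.riesz (v (α i))‖ ^ 2 :=
    tsum_nonneg fun α => sq_nonneg _
  refine (Real.le_sqrt (apply_nonneg _ _) h0).1 ?_
  rw [kernelNorm_apply]
  refine ciSup_le fun F => Real.le_sqrt_of_sq_le ?_
  -- The matrix of `S` against the frame. As functionals on `N`, the frame vectors are the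
  -- combinations `∑ i, T j i • v i`, so the frame coefficients of `A` arise from those along `v`
  -- through a matrix of norm at most `1`.
  let T : Fin F.size → ℕ → ℝ := fun j i => inner ℝ (F.vec j) (S (b i))
  have hTs : ∀ j, Summable fun i => T j i ^ 2 := by
    intro j
    have := b.orthonormal.inner_products_summable (ContinuousLinearMap.adjoint S (F.vec j))
    refine this.congr fun i => ?_
    rw [ContinuousLinearMap.adjoint_inner_right, real_inner_comm, Real.norm_eq_abs, sq_abs]
  have hTv : ∀ j, Summable fun i => T j i • v i := by
    intro j
    refine Summable.of_norm_bounded ((hTs j).add hv.summable) fun i => ?_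
    rw [norm_smul, Real.norm_eq_abs, ← sq_abs (T j i)]
    nlinarith [sq_nonneg (|T j i| - ‖v i‖), sq_nonneg (|T j i|), sq_nonneg ‖v i‖]
  have hu : ∀ j, h.riesz (F.vec j) = h'.riesz (∑' i, T j i • v i) := by
    intro j
    ext ξ
    have h1 := (b.hasSum_repr (ellTwoMap _ hsum ξ)).mapL ((innerSL ℝ (F.vec j)).comp S)
    have h2 := (hTv j).hasSum.mapL ((innerSL ℝ) (h'.toSpace ξ))
    simp only [ContinuousLinearMap.comp_apply, map_smul, hS, innerSL_apply_apply] at h1 h2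
    refine h1.unique ?_
    have e : h'.riesz (∑' i, T j i • v i) ξ = inner ℝ (h'.toSpace ξ) (∑' i, T j i • v i) :=
      real_inner_comm (h'.toSpace ξ) _
    rw [e]
    refine h2.congr_fun fun i => ?_
    have e1 : (b.repr (ellTwoMap _ hsum ξ)) i = inner ℝ (v i) (h'.toSpace ξ) := rfl
    rw [e1, real_inner_comm, smul_eq_mul, smul_eq_mul, mul_comm]
  let B : MultilinearMap ℝ (fun _ : Fin n => h'.Space) ℂ := A.1.compLinearMap fun _ => h'.rieszLinear
  have hB : Continuous B := B.continuous_of_bound _ (norm_kernel_riesz_le h' A)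
  -- The matrix inequality `sum_sq_multilinear_le` is for finite matrices; truncating the series at
  -- `M` and using the continuity of `B` reduces to that case.
  have hlim : Tendsto (fun M : ℕ => ∑ J : Fin n → Fin F.size,
      ‖B fun l => ∑ i ∈ Finset.range M, T (J l) i • v i‖ ^ 2) atTop
      (𝓝 (∑ J : Fin n → Fin F.size, ‖B fun l => ∑' i, T (J l) i • v i‖ ^ 2)) := by
    refine tendsto_finsetSum _ fun J _ => ((hB.tendsto _).comp ?_).norm.pow 2
    exact tendsto_pi_nhds.2 fun l => (hTv (J l)).hasSum.tendsto_sum_nat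
  have e0 : frameNorm h A.1 F ^ 2 =
      ∑ J : Fin n → Fin F.size, ‖B fun l => ∑' i, T (J l) i • v i‖ ^ 2 := by
    rw [frameNorm_sq]
    simp only [hu]
    rfl
  rw [e0]
  refine le_of_tendsto' hlim fun M => ?_
  -- The truncated matrix still has norm at most `1`, by Bessel for the frame and `‖S‖ ≤ 1`.
  have hT : ∀ a : Fin M → ℝ, ∑ j, (∑ i : Fin M, T j i * a i) ^ 2 ≤ 1 ^ 2 * ∑ i, a i ^ 2 := by
    intro a
    let w := ∑ i : Fin M, a i • b i
    have hw : ‖w‖ ^ 2 = ∑ i, a i ^ 2 := by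
      have := (b.orthonormal.comp (fun i : Fin M => (i : ℕ)) Fin.val_injective).inner_sum a a
        Finset.univ
      rw [← real_inner_self_eq_norm_sq]
      refine this.trans (Finset.sum_congr rfl fun l _ => by simp [sq])
    have h1 : ∀ j, ∑ i : Fin M, T j i * a i = inner ℝ (F.vec j) (S w) := by
      intro j
      rw [map_sum, inner_sum]
      refine Finset.sum_congr rfl fun l _ => ?_
      rw [map_smul, real_inner_smul_right, mul_comm]
    have h2 := F.orthonormal.sum_inner_products_le (S w) (s := Finset.univ)
    simp only [Real.norm_eq_abs, sq_abs] at h2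
    simp only [h1]
    refine h2.trans ?_
    rw [one_pow, one_mul, ← hw]
    refine pow_le_pow_left₀ (norm_nonneg _) ?_ 2
    simpa using S.le_of_opNorm_le hS1 w
  have key := sum_sq_multilinear_le (fun i : Fin M => h'.riesz (v i)) (fun j i => T j i) 1 hT n A.1
  rw [one_pow, one_pow, one_mul] at key
  have e1 : ∀ J : Fin n → Fin F.size, (B fun l => ∑ i ∈ Finset.range M, T (J l) i • v i) =
      A.1 fun l => ∑ i : Fin M, T (J l) i • h'.riesz (v i) := by
    intro J
    change A.1 (fun l => h'.rieszLinear (∑ i ∈ Finset.range M, T (J l) i • v i)) = _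
    congr 1
    funext l
    rw [map_sum, Finset.sum_range]
    simp only [map_smul]
    rfl
  simp only [e1]
  refine key.trans ?_
  have hs := hv.summable_norm_kernel_sq A
  rw [← tsum_fintype (L := .unconditional _)]
  exact (Summable.of_finite).tsum_le_tsum_of_inj (fun (I : Fin n → Fin M) i => (I i : ℕ))
    (fun I I' hI => funext fun i => Fin.ext (congrFun hI i)) (fun _ _ => sq_nonneg _)
    (fun _ => le_rfl) hs

end IsHilbertSchmidtSequence

/-! ### Weighted norms of sequences of kernels -/

/-- The weighted norm of finite sequences of kernels, as a seminorm. -/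
def sequenceSeminorm (h : HilbertianNorm N) (q : ℕ) : Seminorm ℂ (Π₀ n : ℕ, Kernel N n) :=
  Seminorm.ofSMulLE (sequenceNorm h q) (sequenceNorm_zero h q) (sequenceNorm_add_le h q)
    (sequenceNorm_smul_le h q)

theorem summable_sequenceNorm (h : HilbertianNorm N) (q : ℕ) (c : Π₀ n : ℕ, Kernel N n) :
    Summable fun n : ℕ => (n.factorial : ℝ) ^ 2 * 2 ^ (n * q) * kernelNorm h (c n) ^ 2 := by
  obtain ⟨s, hs⟩ := kernelNorm_finite_support h c
  exact summable_of_ne_finset_zero (s := s) fun n hn => by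
    rw [hs n hn, zero_pow two_ne_zero, mul_zero]

theorem sequenceNorm_sq (h : HilbertianNorm N) (q : ℕ) (c : Π₀ n : ℕ, Kernel N n) :
    sequenceNorm h q c ^ 2 =
      ∑' n : ℕ, (n.factorial : ℝ) ^ 2 * 2 ^ (n * q) * kernelNorm h (c n) ^ 2 :=
  Real.sq_sqrt (tsum_nonneg fun n => by positivity)

theorem le_sequenceNorm (h : HilbertianNorm N) (q : ℕ) (c : Π₀ n : ℕ, Kernel N n) (n : ℕ) :
    n.factorial * √2 ^ (n * q) * kernelNorm h (c n) ≤ sequenceNorm h q c := by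
  refine (sq_le_sq₀ (mul_nonneg (by positivity) (apply_nonneg _ _)) (sequenceNorm_nonneg _ _ _)).1 ?_
  rw [sequenceNorm_sq]
  refine le_trans (le_of_eq ?_) ((summable_sequenceNorm h q c).le_tsum n fun m _ => by positivity)
  rw [mul_pow, mul_pow, ← pow_mul, mul_comm (n * q) 2, pow_mul, Real.sq_sqrt zero_le_two]

/-- The coefficient of the `n`-th member of a sequence of kernels at the given arguments. -/
def kernelCoefficient {n : ℕ} (x : Fin n → StrongDual ℝ N) :
    (Π₀ n : ℕ, Kernel N n) →ₗ[ℂ] ℂ where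
  toFun c := (c n).1 x
  map_add' _ _ := rfl
  map_smul' _ _ := rfl

/-- The weighted coefficient `n! 2^{nq/2} A(x_{α 1}, …, x_{α n})` of the `n`-th kernel. -/
def weightedCoefficient (x : ℕ → StrongDual ℝ N) (q : ℕ) (i : Σ n : ℕ, Fin n → ℕ) :
    (Π₀ n : ℕ, Kernel N n) →ₗ[ℂ] ℂ :=
  ((i.1.factorial * √2 ^ (i.1 * q) : ℝ) : ℂ) • kernelCoefficient fun l => x (i.2 l)

theorem norm_weightedCoefficient (x : ℕ → StrongDual ℝ N) (q n : ℕ) (α : Fin n → ℕ)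
    (c : Π₀ n : ℕ, Kernel N n) : ‖weightedCoefficient x q ⟨n, α⟩ c‖ =
      n.factorial * √2 ^ (n * q) * ‖(c n).1 fun l => x (α l)‖ := by
  change ‖((n.factorial * √2 ^ (n * q) : ℝ) : ℂ) * ((c n).1 fun l => x (α l))‖ = _
  rw [norm_mul, Complex.norm_real, Real.norm_of_nonneg (by positivity)]

/-- The block of degree `n` contributes at most `(∑' i, s i) ^ n`, so a geometric series dominates.
-/
theorem summable_sigma_prod {s : ℕ → ℝ} (hs0 : ∀ i, 0 ≤ s i) (hs : Summable s)
    (h1 : ∑' i, s i < 1) : Summable fun i : Σ n : ℕ, Fin n → ℕ => ∏ l, s (i.2 l) := by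
  have hp := fun n => summable_prod_pi hs0 hs n
  refine (summable_sigma_of_nonneg fun i => Finset.prod_nonneg fun l _ => hs0 _).2
    ⟨fun n => (hp n).1, ?_⟩
  exact (summable_geometric_of_lt_one (tsum_nonneg hs0) h1).of_nonneg_of_le
    (fun n => tsum_nonneg fun α => Finset.prod_nonneg fun l _ => hs0 _) (fun n => (hp n).2)

/-- Raising `q` by `r` gains `√2 ^ (n * r)` in degree `n`, that is, one factor `√2 ^ r` for each of
the `n` arguments. -/
theorem norm_weightedCoefficient_le {h' : HilbertianNorm N} (v : ℕ → h'.Space) (q r : ℕ)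
    (i : Σ n : ℕ, Fin n → ℕ) (c : Π₀ n : ℕ, Kernel N n) :
    ‖weightedCoefficient (fun j => h'.riesz (v j)) q i c‖ ≤
      (∏ l, (‖v (i.2 l)‖ / √2 ^ r)) * sequenceNorm h' (q + r) c := by
  obtain ⟨n, α⟩ := i
  rw [norm_weightedCoefficient]
  calc _ ≤ n.factorial * √2 ^ (n * q) * (kernelNorm h' (c n) * ∏ l, ‖v (α l)‖) :=
        mul_le_mul_of_nonneg_left (norm_kernel_riesz_le h' (c n) _) (by positivity)
    _ = (∏ l, (‖v (α l)‖ / √2 ^ r)) *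
          (n.factorial * √2 ^ (n * (q + r)) * kernelNorm h' (c n)) := by
        simp only [Finset.prod_div_distrib, Finset.prod_const, Finset.card_univ, Fintype.card_fin]
        rw [mul_add n q r, pow_add, ← pow_mul, mul_comm r n]
        field_simp
    _ ≤ _ := mul_le_mul_of_nonneg_left (le_sequenceNorm h' (q + r) c n)
        (Finset.prod_nonneg fun l _ => by positivity)

theorem IsHilbertSchmidtSequence.sequenceNorm_sq_le {h h' : HilbertianNorm N}
    {v : ℕ → h'.Space} (hv : IsHilbertSchmidtSequence h h' v) (q : ℕ) (c : Π₀ n : ℕ, Kernel N n)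
    (hs : Summable fun i => ‖weightedCoefficient (fun j => h'.riesz (v j)) q i c‖ ^ 2) :
    sequenceNorm h q c ^ 2 ≤
      ∑' i, ‖weightedCoefficient (fun j => h'.riesz (v j)) q i c‖ ^ 2 := by
  rw [sequenceNorm_sq, hs.tsum_sigma]
  refine (summable_sequenceNorm h q c).tsum_le_tsum (fun n => ?_) hs.sigma
  simp only [norm_weightedCoefficient, mul_pow]
  rw [tsum_mul_left, ← pow_mul √2, mul_comm (n * q) 2, pow_mul √2 2,
    Real.sq_sqrt zero_le_two]
  exact mul_le_mul_of_nonneg_left (hv.kernelNorm_sq_le (c n)) (by positivity)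

/-- A Hilbert-Schmidt sequence gives a Hilbert-Schmidt domination of the weighted norms. -/
theorem IsHilbertSchmidtSequence.hilbertSchmidtDominated {h h' : HilbertianNorm N}
    {v : ℕ → h'.Space} (hv : IsHilbertSchmidtSequence h h' v) (q : ℕ) :
    ∃ r : ℕ, HilbertSchmidtDominated (E := Π₀ n : ℕ, Kernel N n) (sequenceSeminorm h q)
      (sequenceSeminorm h' (q + r)) := by
  -- With this `r`, the rescaled sequence `‖v i‖ / √2 ^ r` has square sum below `1`, the ratio of
  -- the geometric series over the degrees.
  obtain ⟨r, hr⟩ := pow_unbounded_of_one_lt (∑' i, ‖v i‖ ^ 2) one_lt_two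
  have hcs : Summable fun i => (‖v i‖ / √2 ^ r) ^ 2 := by
    simp only [div_pow]; exact hv.summable.div_const _
  have hct : ∑' i, (‖v i‖ / √2 ^ r) ^ 2 < 1 := by
    simp only [div_pow]
    rw [tsum_div_const, ← pow_mul, mul_comm r 2, pow_mul, Real.sq_sqrt zero_le_two]
    exact (div_lt_one (by positivity)).2 hr
  have has : Summable fun i : Σ n : ℕ, Fin n → ℕ => (∏ l, (‖v (i.2 l)‖ / √2 ^ r)) ^ 2 := by
    simpa only [Finset.prod_pow] using summable_sigma_prod (fun i => sq_nonneg _) hcs hct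
  refine ⟨r, _, inferInstance, weightedCoefficient (fun j => h'.riesz (v j)) q, _,
    fun i => Finset.prod_nonneg fun l _ => by positivity, has, ?_, ?_⟩
  · exact norm_weightedCoefficient_le v q r
  · exact fun c => hv.sequenceNorm_sq_le q c <|
      (has.mul_right (sequenceNorm h' (q + r) c ^ 2)).of_nonneg_of_le (fun i => sq_nonneg _)
        fun i => by
          rw [← mul_pow]
          exact pow_le_pow_left₀ (norm_nonneg _) (norm_weightedCoefficient_le v q r i c) 2

/-! ### From nuclear maps to Hilbert-Schmidt sequences -/

/-- In a nuclear space, each Hilbertian norm of a system is dominated by a Hilbert-Schmidt sequence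
with respect to another norm of the system. -/
theorem IsNuclearSpace.exists_isHilbertSchmidtSequence (hN : IsNuclearSpace ℝ N)
    (𝓗 : HilbertianSystem N) (h : HilbertianNorm N) :
    ∃ (k : ℕ) (v : ℕ → (𝓗.norm k).Space), IsHilbertSchmidtSequence h (𝓗.norm k) v := by
  obtain ⟨Q, hQ, hQc, f, y, hs, hT⟩ := hN.nuclear h.seminorm h.continuous_seminorm
  obtain ⟨k, C, hC, hQk⟩ := WithSeminorms.exists_le_smul 𝓗.withSeminorms
    (fun i j hij => 𝓗.mono i j hij) Q hQc
  let h' := 𝓗.norm k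
  let s : ℕ → ℝ := fun n => ‖f n‖ * ‖y n‖
  have hs0 : ∀ n, 0 ≤ s n := fun n => by positivity
  let g : ℕ → N →ₗ[ℝ] ℝ := fun n => (f n : LocalBanach Q →ₗ[ℝ] ℝ) ∘ₗ toLocalBanachLinear Q
  have hg : ∀ n ξ, |g n ξ| ≤ ‖f n‖ * C * h'.seminorm ξ := by
    intro n ξ
    calc |g n ξ| ≤ ‖f n‖ * ‖toLocalBanach Q ξ‖ := (f n).le_opNorm _
      _ ≤ ‖f n‖ * (C * h'.seminorm ξ) := by
        rw [norm_toLocalBanach]; exact mul_le_mul_of_nonneg_left (hQk ξ) (norm_nonneg _)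
      _ = _ := (mul_assoc _ _ _).symm
  choose u hu hug using fun n => h'.exists_riesz_eq (g n) (mul_nonneg (norm_nonneg _) hC) (hg n)
  set σ := ∑' n, s n with hσ
  have hσ0 : 0 ≤ σ := tsum_nonneg hs0
  have hsq : ∀ n, √(s n) ^ 2 = s n := fun n => Real.sq_sqrt (hs0 n)
  -- Each term is split evenly between two square summable sequences, `√(s n)` and `t n * |g n ξ|`.
  -- If `s n = 0`, the convention `x / 0 = 0` gives `t n = 0`, and the term vanishes anyway.
  let t : ℕ → ℝ := fun n => ‖y n‖ / √(s n)
  have hts : ∀ n, t n ^ 2 * ‖f n‖ ^ 2 ≤ s n := by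
    intro n
    rcases (hs0 n).eq_or_lt with h0 | h0
    · simp [t, ← h0]
    · simp only [t]
      rw [div_pow, hsq, div_mul_eq_mul_div, div_le_iff₀ h0]
      simp only [s]
      exact le_of_eq (by ring)
  have hgy : ∀ n ξ, |g n ξ| * ‖y n‖ = √(s n) * (t n * |g n ξ|) := by
    intro n ξ
    rcases (hs0 n).eq_or_lt with h0 | h0
    · have h1 : |g n ξ| * ‖y n‖ = 0 := by
        rcases mul_eq_zero.1 h0.symm with h1 | h1
        · have := hg n ξ
          rw [h1, zero_mul, zero_mul] at this
          rw [le_antisymm this (abs_nonneg _), zero_mul]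
        · rw [h1, mul_zero]
      rw [h1, ← h0, Real.sqrt_zero, zero_mul]
    · have : √(s n) ≠ 0 := (Real.sqrt_pos.2 h0).ne'
      simp only [t]
      field_simp
  -- The factor `√σ` anticipates the constant `σ = ∑' n, s n` of the Cauchy-Schwarz inequality in
  -- `hpartial`.
  have hvn : ∀ n, ‖(√σ * t n) • u n‖ ^ 2 ≤ σ * C ^ 2 * s n := by
    intro n
    rw [norm_smul, mul_pow, Real.norm_eq_abs, sq_abs, mul_pow, Real.sq_sqrt hσ0]
    calc σ * t n ^ 2 * ‖u n‖ ^ 2 ≤ σ * t n ^ 2 * (‖f n‖ * C) ^ 2 := by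
          gcongr; exact hu n
      _ = σ * C ^ 2 * (t n ^ 2 * ‖f n‖ ^ 2) := by ring
      _ ≤ _ := mul_le_mul_of_nonneg_left (hts n) (by positivity)
  have hvs : Summable fun n => ‖(√σ * t n) • u n‖ ^ 2 :=
    (hs.mul_left (σ * C ^ 2)).of_nonneg_of_le (fun _ => sq_nonneg _) hvn
  have hva : ∀ n ξ, h'.riesz ((√σ * t n) • u n) ξ = √σ * (t n * g n ξ) := by
    intro n ξ
    rw [← h'.rieszLinear_apply, map_smul, h'.rieszLinear_apply]
    change (√σ * t n) * h'.riesz (u n) ξ = _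
    rw [hug, mul_assoc]
  refine ⟨k, fun n => (√σ * t n) • u n, hvs, fun ξ => ?_⟩
  have hzs : Summable fun n => (t n * |g n ξ|) ^ 2 := by
    refine (hs.mul_left ((C * h'.seminorm ξ) ^ 2)).of_nonneg_of_le (fun _ => sq_nonneg _)
      fun n => ?_
    calc (t n * |g n ξ|) ^ 2 = t n ^ 2 * |g n ξ| ^ 2 := mul_pow _ _ _
      _ ≤ t n ^ 2 * (‖f n‖ * C * h'.seminorm ξ) ^ 2 := by gcongr; exact hg n ξ
      _ = (C * h'.seminorm ξ) ^ 2 * (t n ^ 2 * ‖f n‖ ^ 2) := by ring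
      _ ≤ _ := mul_le_mul_of_nonneg_left (hts n) (by positivity)
  have h1 := hT (toLocalBanach Q ξ)
  rw [canonicalMap_toLocalBanach] at h1
  have hz0 : 0 ≤ ∑' n, (t n * |g n ξ|) ^ 2 := tsum_nonneg fun _ => sq_nonneg _
  have hpartial : ∀ M : Finset ℕ,
      ‖∑ n ∈ M, f n (toLocalBanach Q ξ) • y n‖ ^ 2 ≤ σ * ∑' n, (t n * |g n ξ|) ^ 2 := by
    intro M
    calc _ ≤ (∑ n ∈ M, √(s n) * (t n * |g n ξ|)) ^ 2 := by
          refine pow_le_pow_left₀ (norm_nonneg _) ((norm_sum_le _ _).trans (le_of_eq ?_)) 2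
          refine Finset.sum_congr rfl fun n _ => ?_
          rw [norm_smul, ← hgy]; rfl
      _ ≤ (∑ n ∈ M, √(s n) ^ 2) * ∑ n ∈ M, (t n * |g n ξ|) ^ 2 :=
          Finset.sum_mul_sq_le_sq_mul_sq _ _ _
      _ ≤ _ := by
          simp only [hsq]
          exact mul_le_mul (hs.sum_le_tsum _ fun n _ => hs0 n)
            (hzs.sum_le_tsum _ fun _ _ => sq_nonneg _)
            (Finset.sum_nonneg fun _ _ => sq_nonneg _) hσ0
  have h2 : ‖toLocalBanach h.seminorm ξ‖ ^ 2 ≤ σ * ∑' n, (t n * |g n ξ|) ^ 2 :=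
    le_of_tendsto' (h1.norm.pow 2) hpartial
  rw [norm_toLocalBanach] at h2
  refine h2.trans (le_of_eq ?_)
  rw [← tsum_mul_left]
  refine tsum_congr fun n => ?_
  rw [hva, mul_pow √σ, Real.sq_sqrt hσ0, mul_pow, mul_pow, sq_abs]

end KernelBounds

/-! ### The test function space -/

section NuclearCriterion

variable {𝕜 : Type*} [RCLike 𝕜]

/-- A bounded operator that has a nuclear expansion on a dense set is nuclear. -/
theorem IsNuclearMap.of_dense {X Y : Type*} [NormedAddCommGroup X] [NormedSpace 𝕜 X]
    [NormedAddCommGroup Y] [NormedSpace 𝕜 Y] [CompleteSpace Y] (T : X →L[𝕜] Y)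
    (f : ℕ → StrongDual 𝕜 X) (y : ℕ → Y) (hs : Summable fun n => ‖f n‖ * ‖y n‖) {D : Set X}
    (hD : Dense D) (h : ∀ x ∈ D, HasSum (fun n => f n x • y n) (T x)) : IsNuclearMap T := by
  obtain ⟨Θ, hΘ⟩ := exists_continuousLinearMap_hasSum f y hs
  have e : (Θ : X → Y) = T := Continuous.ext_on hD Θ.continuous T.continuous
    fun x hx => (hΘ x).unique (h x hx)
  exact ⟨f, y, hs, fun x => by rw [← congrFun e x]; exact hΘ x⟩

/-- Let `p ≤ q` be seminorms on `E` such that, on a `q`-dense subspace `V`, the seminorm `p` is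
bounded by a multiple of `P` and `P'` is bounded by `q`. If `P` is nuclearly dominated by `P'`, then
the canonical map from the completion of `(E, q)` to the completion of `(E, p)` is nuclear. -/
theorem isNuclearMap_canonicalMap {E V : Type*} [AddCommGroup E] [Module 𝕜 E] [AddCommGroup V]
    [Module 𝕜 V] (j : V →ₗ[𝕜] E) {P P' : Seminorm 𝕜 V} (hPP' : NuclearDominated P P')
    {p q : Seminorm 𝕜 E} (hpq : p ≤ q) {C : ℝ} (hpP : ∀ φ, p (j φ) ≤ C * P φ)
    (hP'q : ∀ φ, P' φ ≤ q (j φ)) (hj : ∀ x, ∀ ε > 0, ∃ φ, q (x - j φ) < ε) :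
    IsNuclearMap (canonicalMap hpq) := by
  obtain ⟨f, y, a, ha, hay, hfa, hfy⟩ := hPP'
  have hd : DenseRange (toLocalBanachLinear q ∘ₗ j) := by
    rw [DenseRange, dense_iff_closure_eq, Set.eq_univ_iff_forall]
    refine isClosed_property (denseRange_toLocalBanach q) isClosed_closure fun x => ?_
    refine Metric.mem_closure_iff.2 fun ε hε => ?_
    obtain ⟨φ, hφ⟩ := hj x ε hε
    refine ⟨_, ⟨φ, rfl⟩, ?_⟩
    rw [dist_eq_norm, LinearMap.comp_apply, ← toLocalBanachLinear_apply, ← map_sub,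
      norm_toLocalBanachLinear]
    exact hφ
  have hT : ∀ φ, ‖(toLocalBanachLinear p ∘ₗ j) φ‖ ≤ C * ‖toLocalBanachLinear P φ‖ := fun φ => by
    rw [LinearMap.comp_apply, norm_toLocalBanachLinear, norm_toLocalBanachLinear]; exact hpP φ
  have hf : ∀ n φ, ‖f n φ‖ ≤ a n * ‖(toLocalBanachLinear q ∘ₗ j) φ‖ := fun n φ => by
    rw [LinearMap.comp_apply, norm_toLocalBanachLinear]
    exact (hfa n φ).trans (mul_le_mul_of_nonneg_left (hP'q φ) (ha n))
  -- `T` carries the vectors of the expansion into the completion of `(E, p)`; the `g n` extend its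
  -- functionals from the dense image of `V` to the completion of `(E, q)`.
  let T := (toLocalBanachLinear p ∘ₗ j).extendOfNorm (toLocalBanachLinear P)
  let g : ℕ → StrongDual 𝕜 (LocalBanach q) := fun n => (f n).extendOfNorm (toLocalBanachLinear q ∘ₗ j)
  have hg : ∀ n, ‖g n‖ ≤ a n := fun n => LinearMap.opNorm_extendOfNorm_le hd (ha n) (hf n)
  refine IsNuclearMap.of_dense _ g (fun n => T (y n)) ?_ hd ?_
  · refine (hay.mul_left ‖T‖).of_nonneg_of_le (fun n => by positivity) fun n => ?_
    calc ‖g n‖ * ‖T (y n)‖ ≤ a n * (‖T‖ * ‖y n‖) :=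
          mul_le_mul (hg n) (T.le_opNorm _) (norm_nonneg _) (ha n)
      _ = _ := by ring
  · rintro _ ⟨φ, rfl⟩
    have h1 := (hfy φ).mapL T
    have e1 : T (toLocalBanach P φ) = toLocalBanach p (j φ) :=
      LinearMap.extendOfNorm_eq (denseRange_toLocalBanachLinear P) ⟨C, hT⟩ φ
    have e2 : ∀ n, g n ((toLocalBanachLinear q ∘ₗ j) φ) = f n φ := fun n =>
      LinearMap.extendOfNorm_eq hd ⟨a n, hf n⟩ φ
    have e3 : canonicalMap hpq ((toLocalBanachLinear q ∘ₗ j) φ) = toLocalBanach p (j φ) :=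
      canonicalMap_toLocalBanach hpq (j φ)
    simp only [e1, map_smul] at h1
    simp only [e2, e3]
    exact h1

/-- A subspace is dense if it is dense for each of a directed system of seminorms. -/
theorem WithSeminorms.denseRange {E V ι : Type*} [AddCommGroup E] [Module 𝕜 E]
    [TopologicalSpace E] [Preorder ι] [IsDirectedOrder ι] [Nonempty ι] {ρ : ι → Seminorm 𝕜 E}
    (hρ : WithSeminorms ρ) (hmono : Monotone ρ) (j : V → E)
    (hj : ∀ i x, ∀ ε > 0, ∃ φ, ρ i (x - j φ) < ε) : DenseRange j := by
  intro x
  refine mem_closure_iff_nhds.2 fun U hU => ?_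
  obtain ⟨s, r, hr, hs⟩ := (hρ.mem_nhds_iff x U).1 hU
  obtain ⟨i, hi⟩ := s.exists_le
  obtain ⟨φ, hφ⟩ := hj i x r hr
  refine ⟨_, hs ?_, ⟨φ, rfl⟩⟩
  rw [Seminorm.mem_ball, map_sub_rev]
  exact lt_of_le_of_lt (Finset.sup_le (fun l hl => hmono (hi l hl)) _) hφ

/-- A Hausdorff space with a directed system of seminorms is nuclear if the restrictions of these
seminorms to a dense subspace are nuclearly dominated by each other. -/
theorem IsNuclearSpace.of_withSeminorms {E V ι : Type*} [AddCommGroup E] [Module 𝕜 E]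
    [TopologicalSpace E] [T2Space E] [AddCommGroup V] [Module 𝕜 V] [Preorder ι] [IsDirectedOrder ι]
    [Nonempty ι] {ρ : ι → Seminorm 𝕜 E} (hρ : WithSeminorms ρ) (hmono : Monotone ρ)
    (j : V →ₗ[𝕜] E) (hj : ∀ i x, ∀ ε > 0, ∃ φ, ρ i (x - j φ) < ε) {P : ι → Seminorm 𝕜 V}
    (hP : ∀ i φ, ρ i (j φ) = P i φ) (hnuc : ∀ i, ∃ i', NuclearDominated (P i) (P i')) :
    IsNuclearSpace 𝕜 E where
  isTopologicalAddGroup := hρ.topologicalAddGroup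
  continuousSMul := hρ.continuousSMul
  t2 := inferInstance
  locallyConvex U hU := by
    obtain ⟨s, r, hr, hs⟩ := (hρ.mem_nhds_iff 0 U).1 hU
    obtain ⟨i, hi⟩ := s.exists_le
    refine ⟨r⁻¹.toNNReal • ρ i, ?_, fun f hf => hs ?_⟩
    · exact (hρ.continuous_seminorm i).const_smul r⁻¹.toNNReal
    · rw [Seminorm.mem_ball_zero]
      refine lt_of_le_of_lt (Finset.sup_le (fun l hl => hmono (hi l hl)) _) ?_
      have h1 : (r⁻¹.toNNReal : ℝ) * ρ i f < 1 := hf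
      rwa [Real.coe_toNNReal _ (inv_nonneg.2 hr.le), inv_mul_lt_iff₀ hr, mul_one] at h1
  nuclear p hp := by
    obtain ⟨i, C, hC, hpi⟩ := WithSeminorms.exists_le_smul hρ hmono p hp
    obtain ⟨i', hii'⟩ := hnuc i
    -- Taking the supremum with `p` ensures `p ≤ q` without a constant, whereas `ρ i'` alone might
    -- bound `p` only up to a factor.
    have hq : Continuous (p ⊔ ρ i' : Seminorm 𝕜 E) := hp.sup (hρ.continuous_seminorm i')
    refine ⟨p ⊔ ρ i', le_sup_left, hq, ?_⟩
    refine isNuclearMap_canonicalMap j hii' le_sup_left (C := C) (fun φ => ?_)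
      (fun φ => ?_) fun f ε hε => ?_
    · rw [← hP]; exact hpi _
    · rw [← hP i']; exact le_sup_right
    · obtain ⟨l, D, hD, hql⟩ := WithSeminorms.exists_le_smul hρ hmono _ hq
      obtain ⟨φ, hφ⟩ := hj l f (ε / (D + 1)) (by positivity)
      refine ⟨φ, (hql _).trans_lt ?_⟩
      rw [lt_div_iff₀ (by positivity)] at hφ
      nlinarith [apply_nonneg (ρ l) (f - j φ)]

end NuclearCriterion

/-! ### Norms of polynomials as quotient norms -/

section TestSpaceTheory

variable {N : Type*} [AddCommGroup N] [Module ℝ N] [TopologicalSpace N] [IsTopologicalAddGroup N]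
  {μ : @Measure (StrongDual ℝ N) (cylinderSigma N)}

/-- This and `exists_sequenceNorm_lt` express that `polynomialNorm` is a quotient seminorm; the
nuclear domination uses nothing else about the infimum. -/
theorem polynomialNorm_rangeRestrict_le (h : HilbertianNorm N) (q : ℕ) (c : Π₀ n : ℕ, Kernel N n) :
    polynomialNorm μ h q ((appellSum μ).rangeRestrict c) ≤ sequenceNorm h q c :=
  ciInf_le_of_le ⟨0, by rintro _ ⟨c, rfl⟩; exact sequenceNorm_nonneg _ _ _⟩ ⟨c, rfl⟩ le_rfl

theorem exists_sequenceNorm_lt (h : HilbertianNorm N) (q : ℕ) (φ : Polynomials μ) {ε : ℝ}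
    (hε : 0 < ε) : ∃ c, (appellSum μ).rangeRestrict c = φ ∧
      sequenceNorm h q c < polynomialNorm μ h q φ + ε := by
  have : Nonempty {c : Π₀ n : ℕ, Kernel N n // appellSum μ c = φ.1} := by
    obtain ⟨c, hc⟩ := φ.2; exact ⟨⟨c, hc⟩⟩
  obtain ⟨c, hc⟩ := exists_lt_of_ciInf_lt (lt_add_of_pos_right (polynomialNorm μ h q φ) hε)
  exact ⟨c.1, Subtype.ext c.2, hc⟩

/-- The quotient criterion for finite sequences with entries in given complex vector spaces. -/
theorem NuclearDominated.of_quotient_dfinsupp {K : ℕ → Type*} {V : Type*}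
    [∀ n, AddCommGroup (K n)] [∀ n, Module ℂ (K n)] [AddCommGroup V] [Module ℂ V]
    (s : (Π₀ n, K n) →ₗ[ℂ] V) (hs : Function.Surjective s) {P R Q Q' : Seminorm ℂ (Π₀ n, K n)}
    (hPR : HilbertSchmidtDominated P R) (hRQ : HilbertSchmidtDominated R Q)
    (hQQ' : HilbertSchmidtDominated Q Q') {P₀ Q₀ : Seminorm ℂ V} (hP₀ : ∀ c, P₀ (s c) ≤ P c)
    (hQ₀ : ∀ φ, ∀ ε > 0, ∃ c, s c = φ ∧ Q' c ≤ Q₀ φ + ε) : NuclearDominated P₀ Q₀ :=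
  NuclearDominated.of_quotient s hs hPR hRQ hQQ' hP₀ hQ₀

/-- Every norm of the space of polynomials is nuclearly dominated by another one. -/
theorem exists_nuclearDominated_polynomialNorm (hN : IsNuclearSpace ℝ N) (𝓗 : HilbertianSystem N)
    (h : HilbertianNorm N) (q : ℕ) :
    ∃ k r : ℕ, NuclearDominated (polynomialNorm μ h q) (polynomialNorm μ (𝓗.norm k) r) := by
  -- Three successive steps: two for the expansion, one for the descent along `appellSum`.
  obtain ⟨k₁, v₁, h₁⟩ := hN.exists_isHilbertSchmidtSequence 𝓗 h
  obtain ⟨k₂, v₂, h₂⟩ := hN.exists_isHilbertSchmidtSequence 𝓗 (𝓗.norm k₁)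
  obtain ⟨k₃, v₃, h₃⟩ := hN.exists_isHilbertSchmidtSequence 𝓗 (𝓗.norm k₂)
  obtain ⟨r₁, d₁⟩ := h₁.hilbertSchmidtDominated q
  obtain ⟨r₂, d₂⟩ := h₂.hilbertSchmidtDominated (q + r₁)
  obtain ⟨r₃, d₃⟩ := h₃.hilbertSchmidtDominated (q + r₁ + r₂)
  refine ⟨k₃, q + r₁ + r₂ + r₃, ?_⟩
  have hQ : ∀ φ : Polynomials μ, ∀ ε > 0, ∃ c, (appellSum μ).rangeRestrict c = φ ∧
      sequenceSeminorm (𝓗.norm k₃) (q + r₁ + r₂ + r₃) c ≤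
        polynomialNorm μ (𝓗.norm k₃) (q + r₁ + r₂ + r₃) φ + ε := fun φ ε hε => by
    obtain ⟨c, hc, hlt⟩ := exists_sequenceNorm_lt (𝓗.norm k₃) (q + r₁ + r₂ + r₃) φ hε
    exact ⟨c, hc, hlt.le⟩
  have hP : ∀ c, polynomialNorm μ h q ((appellSum μ).rangeRestrict c) ≤ sequenceSeminorm h q c :=
    polynomialNorm_rangeRestrict_le h q
  have hs := (appellSum μ).surjective_rangeRestrict
  exact NuclearDominated.of_quotient_dfinsupp (K := fun n => Kernel N n) (V := Polynomials μ)
    (P := sequenceSeminorm h q) (Q' := sequenceSeminorm (𝓗.norm k₃) (q + r₁ + r₂ + r₃))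
    (appellSum μ).rangeRestrict hs d₁ d₂ d₃ hP hQ

/-! ### Comparison of norms from different systems -/

theorem kernelNorm_le_of_le {n : ℕ} {h h' : HilbertianNorm N} {C : ℝ} (hC : 0 ≤ C)
    (hle : ∀ ξ, h.seminorm ξ ≤ C * h'.seminorm ξ) (A : Kernel N n) :
    kernelNorm h A ≤ C ^ n * kernelNorm h' A := by
  rw [kernelNorm_apply]
  refine ciSup_le fun F => ?_
  obtain ⟨F', hF'⟩ := frameNorm_le_of_le hC hle A.1 F
  exact hF'.trans (mul_le_mul_of_nonneg_left (le_ciSup (A.2.2 h') F') (pow_nonneg hC n))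

/-- The constant `C ^ n` of degree `n` grows only geometrically, so the extra weight `2 ^ (n * r)`
absorbs it. This is why all `q` have to enter the projective limit. -/
theorem sequenceNorm_le_of_le {h h' : HilbertianNorm N} {C : ℝ} (hC : 0 ≤ C)
    (hle : ∀ ξ, h.seminorm ξ ≤ C * h'.seminorm ξ) {r : ℕ} (hr : C ^ 2 ≤ 2 ^ r) (q : ℕ)
    (c : Π₀ n : ℕ, Kernel N n) : sequenceNorm h q c ≤ sequenceNorm h' (q + r) c := by
  refine Real.sqrt_le_sqrt ((summable_sequenceNorm h q c).tsum_le_tsum (fun n => ?_)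
    (summable_sequenceNorm h' (q + r) c))
  calc (n.factorial : ℝ) ^ 2 * 2 ^ (n * q) * kernelNorm h (c n) ^ 2
      ≤ n.factorial ^ 2 * 2 ^ (n * q) * (C ^ n * kernelNorm h' (c n)) ^ 2 := by
        refine mul_le_mul_of_nonneg_left ?_ (by positivity)
        exact pow_le_pow_left₀ (apply_nonneg _ _) (kernelNorm_le_of_le hC hle (c n)) 2
    _ = (C ^ 2) ^ n * (n.factorial ^ 2 * 2 ^ (n * q) * kernelNorm h' (c n) ^ 2) := by ring
    _ ≤ (2 ^ r) ^ n * (n.factorial ^ 2 * 2 ^ (n * q) * kernelNorm h' (c n) ^ 2) := by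
        gcongr
    _ = _ := by ring

theorem polynomialNorm_le_of_le {h h' : HilbertianNorm N} {C : ℝ} (hC : 0 ≤ C)
    (hle : ∀ ξ, h.seminorm ξ ≤ C * h'.seminorm ξ) {r : ℕ} (hr : C ^ 2 ≤ 2 ^ r) (q : ℕ) :
    polynomialNorm μ h q ≤ polynomialNorm μ h' (q + r) := fun φ => by
  have : Nonempty {c : Π₀ n : ℕ, Kernel N n // appellSum μ c = φ.1} := by
    obtain ⟨c, hc⟩ := φ.2; exact ⟨⟨c, hc⟩⟩
  exact ciInf_mono ⟨0, by rintro _ ⟨c, rfl⟩; exact sequenceNorm_nonneg _ _ _⟩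
    fun c => sequenceNorm_le_of_le hC hle hr q c.1

/-- Each norm of the space of polynomials is bounded by one that belongs to a given system. -/
theorem exists_polynomialNorm_le (𝓗 : HilbertianSystem N) (h : HilbertianNorm N) (q : ℕ) :
    ∃ i : ℕ × ℕ, polynomialNorm μ h q ≤ polynomialNorm μ (𝓗.norm i.1) i.2 := by
  obtain ⟨k, C, hC, hle⟩ := WithSeminorms.exists_le_smul 𝓗.withSeminorms
    (fun i j hij => 𝓗.mono i j hij) h.seminorm h.continuous_seminorm
  obtain ⟨r, hr⟩ := pow_unbounded_of_one_lt (C ^ 2) one_lt_two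
  exact ⟨(k, q + r), polynomialNorm_le_of_le hC hle hr.le q⟩

/-! ### The projective limit -/

namespace TestSpace

variable (μ) in
/-- The norm `‖·‖_{p,q,μ}` on the test function space. -/
def seminorm (𝓗 : HilbertianSystem N) (i : ℕ × ℕ) : Seminorm ℂ (TestSpace μ 𝓗) :=
  (normSeminorm ℂ (HilbertTestSpace μ 𝓗 i.1 i.2)).comp
    (LinearMap.proj i ∘ₗ (TestSpace μ 𝓗).subtype)

variable {𝓗 : HilbertianSystem N}

theorem seminorm_apply (i : ℕ × ℕ) (f : TestSpace μ 𝓗) : seminorm μ 𝓗 i f = ‖f.1 i‖ := rfl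

theorem norm_linkingMap_le {p p' q q' : ℕ} (hp : p ≤ p') (hq : q ≤ q')
    (f : HilbertTestSpace μ 𝓗 p' q') : ‖linkingMap μ 𝓗 hp hq f‖ ≤ ‖f‖ := by
  refine isClosed_property (denseRange_toLocalBanach _)
    (isClosed_le (linkingMap μ 𝓗 hp hq).continuous.norm continuous_norm) (fun φ => ?_) f
  rw [linkingMap, canonicalMap_toLocalBanach, norm_toLocalBanach, norm_toLocalBanach]
  exact polynomialNorm_mono μ (𝓗.mono p p' hp) hq φ

theorem monotone_seminorm : Monotone (seminorm μ 𝓗) := fun i i' hi f => by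
  rw [seminorm_apply, seminorm_apply, ← f.2 i.1 i'.1 i.2 i'.2 hi.1 hi.2]
  exact norm_linkingMap_le _ _ _

theorem withSeminorms : WithSeminorms (seminorm μ 𝓗) := by
  have h := (TestSpace μ 𝓗).subtype.withSeminorms_induced (withSeminorms_pi
    fun i : ℕ × ℕ => norm_withSeminorms ℂ (HilbertTestSpace μ 𝓗 i.1 i.2))
  -- A normed space carries its seminorm family indexed by `Fin 1`, so the product family has to be
  -- reindexed.
  exact h.congr_equiv (Equiv.sigmaUnique (ℕ × ℕ) fun _ => Fin 1).symm

/-- The canonical map of the space of polynomials into the test function space. -/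
def ofPolynomial (μ : @Measure (StrongDual ℝ N) (cylinderSigma N)) (𝓗 : HilbertianSystem N) :
    Polynomials μ →ₗ[ℂ] TestSpace μ 𝓗 where
  toFun := toTestSpace μ 𝓗
  map_add' φ ψ := Subtype.ext <| funext fun _ => map_add (toLocalBanachLinear _) φ ψ
  map_smul' a φ := Subtype.ext <| funext fun _ => map_smul (toLocalBanachLinear _) a φ

theorem seminorm_ofPolynomial (i : ℕ × ℕ) (φ : Polynomials μ) :
    seminorm μ 𝓗 i (ofPolynomial μ 𝓗 φ) = polynomialNorm μ (𝓗.norm i.1) i.2 φ :=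
  norm_toLocalBanach _ φ

theorem exists_seminorm_sub_lt (i : ℕ × ℕ) (f : TestSpace μ 𝓗) {ε : ℝ} (hε : 0 < ε) :
    ∃ φ, seminorm μ 𝓗 i (f - ofPolynomial μ 𝓗 φ) < ε := by
  obtain ⟨φ, hφ⟩ := (denseRange_toLocalBanach _).exists_dist_lt (f.1 i) hε
  exact ⟨φ, by rw [dist_eq_norm] at hφ; exact hφ⟩

theorem denseRange_ofPolynomial : DenseRange (ofPolynomial μ 𝓗) :=
  withSeminorms.denseRange monotone_seminorm _ fun i f _ hε => exists_seminorm_sub_lt i f hε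

/-- The test function space is nuclear. -/
theorem isNuclearSpace (hN : IsNuclearSpace ℝ N) (𝓗 : HilbertianSystem N) :
    IsNuclearSpace ℂ (TestSpace μ 𝓗) :=
  IsNuclearSpace.of_withSeminorms withSeminorms monotone_seminorm (ofPolynomial μ 𝓗)
    (fun i f _ hε => exists_seminorm_sub_lt i f hε) seminorm_ofPolynomial fun i => by
      obtain ⟨k, r, h⟩ := exists_nuclearDominated_polynomialNorm (μ := μ) hN 𝓗 (𝓗.norm i.1) i.2
      exact ⟨(k, r), h⟩

/-- The identity of the space of polynomials extends to a continuous linear map between the test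
function spaces of two systems of norms. -/
theorem exists_continuousLinearMap (𝓗 𝓗' : HilbertianSystem N) :
    ∃ Φ : TestSpace μ 𝓗 →L[ℂ] TestSpace μ 𝓗',
      ∀ φ, Φ (ofPolynomial μ 𝓗 φ) = ofPolynomial μ 𝓗' φ := by
  choose i hi using fun j : ℕ × ℕ => exists_polynomialNorm_le (μ := μ) 𝓗 (𝓗'.norm j.1) j.2
  -- The coordinate `j` of the target is read off from the single coordinate `i j` of the source,
  -- whose norm dominates it on polynomials.
  let G : TestSpace μ 𝓗 →L[ℂ] (∀ j : ℕ × ℕ, HilbertTestSpace μ 𝓗' j.1 j.2) :=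
    ContinuousLinearMap.pi fun j => (canonicalMap (hi j)).comp
      ((ContinuousLinearMap.proj (i j)).comp (TestSpace μ 𝓗).subtypeL)
  have hG : ∀ φ, G (ofPolynomial μ 𝓗 φ) = (ofPolynomial μ 𝓗' φ).1 := fun φ =>
    funext fun j => canonicalMap_toLocalBanach (hi j) φ
  have hmem : ∀ f, G f ∈ TestSpace μ 𝓗' := by
    intro f p p' q q' hp hq
    -- Compatibility of the coordinates is a closed condition, and it holds on the dense set of
    -- polynomials.
    refine isClosed_property (p := fun f => linkingMap μ 𝓗' hp hq (G f (p', q')) = G f (p, q))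
      denseRange_ofPolynomial (isClosed_eq ?_ ?_) (fun φ => ?_) f
    · exact (linkingMap μ 𝓗' hp hq).continuous.comp ((continuous_apply (p', q')).comp G.continuous)
    · exact (continuous_apply (p, q)).comp G.continuous
    · rw [hG]
      exact (ofPolynomial μ 𝓗' φ).2 p p' q q' hp hq
  exact ⟨G.codRestrict _ hmem, fun φ => Subtype.ext (hG φ)⟩

/-- The test function space does not depend on the system of norms. -/
theorem existsUnique_continuousLinearEquiv (𝓗 𝓗' : HilbertianSystem N) :
    ∃! e : TestSpace μ 𝓗 ≃L[ℂ] TestSpace μ 𝓗',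
      ∀ φ : Polynomials μ, e (toTestSpace μ 𝓗 φ) = toTestSpace μ 𝓗' φ := by
  obtain ⟨Φ, hΦ⟩ := exists_continuousLinearMap (μ := μ) 𝓗 𝓗'
  obtain ⟨Ψ, hΨ⟩ := exists_continuousLinearMap (μ := μ) 𝓗' 𝓗
  -- Both composites are the identity on polynomials, hence everywhere by density; the uniqueness of
  -- `e` below follows in the same way.
  have h1 : ∀ f, Ψ (Φ f) = f := congrFun <|
    denseRange_ofPolynomial.equalizer (Ψ.continuous.comp Φ.continuous) continuous_id <|
      funext fun φ => by simp only [Function.comp_apply, hΦ, hΨ]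
  have h2 : ∀ f, Φ (Ψ f) = f := congrFun <|
    denseRange_ofPolynomial.equalizer (Φ.continuous.comp Ψ.continuous) continuous_id <|
      funext fun φ => by simp only [Function.comp_apply, hΦ, hΨ]
  refine ⟨ContinuousLinearEquiv.equivOfInverse Φ Ψ h1 h2, hΦ, fun e he => ?_⟩
  refine ContinuousLinearEquiv.ext (denseRange_ofPolynomial.equalizer e.continuous Φ.continuous <| funext fun φ => ?_)
  exact (he φ).trans (hΦ φ).symm

end TestSpace

end TestSpaceTheory

end

/-- The test function space is nuclear, and it does not depend on the choice of the system of
Hilbertian norms: the spaces constructed from two systems which define the topology of `N` are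
isomorphic as topological vector spaces, by a unique isomorphism which is the identity on
the polynomials. -/
theorem mainTheorem5 {N : Type*} [AddCommGroup N] [Module ℝ N] [UniformSpace N]
    [IsUniformAddGroup N] [CompleteSpace N] (hN : IsNuclearSpace ℝ N)
    (μ : @Measure (StrongDual ℝ N) (cylinderSigma N)) [IsProbabilityMeasure μ]
    (hμ : HasAnalyticLaplaceTransform μ) :
    (∀ 𝓗 : HilbertianSystem N, IsNuclearSpace ℂ (TestSpace μ 𝓗)) ∧
      ∀ 𝓗 𝓗' : HilbertianSystem N,
        ∃! e : TestSpace μ 𝓗 ≃L[ℂ] TestSpace μ 𝓗',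
          ∀ φ : Polynomials μ, e (toTestSpace μ 𝓗 φ) = toTestSpace μ 𝓗' φ :=
  ⟨TestSpace.isNuclearSpace hN, TestSpace.existsUnique_continuousLinearEquiv⟩
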